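/- Let $k$ be an infinite field. All graphs are finite and simple, possibly with isolated vertices. For a graph $G$ with vertex set $V(G)$ and edge set $E(G)$, let $S=k[x_v : v\in V(G)]$ with its standard grading, let $I(G)=\langle x_ux_v : uv\in E(G)\rangle\subseteq S$ be the edge ideal of $G$, and for a homogeneous ideal $J\subseteq S$ let $$\operatorname{reg} J=\max\{\,j-i : \operatorname{Tor}^S_i(J,k)_j\neq 0\,\},$$ with $\operatorname{reg} 0=-\infty$. For $u\in V(G)$, let $N_G[u]$ consist of $u$ and its neighbors, and for $W\subseteq V(G)$ let $G-W$ be the induced subgraph of $G$ on $V(G)\setminus W$, with $G-u=G-\{u\}$. Call a graph nonempty if it has at least one edge. A collection $\mathcal F$ of graphs is a hierarchy if for every nonempty graph $G\in\mathcal F$ and every vertex $u\in V(G)$, both $G-u$ and $G-N_G[u]$ are in $\mathcal F$. Theorem 3.2. Let $\mathcal F$ be a hierarchy and let $f:\mathcal F\to\mathbb N$ be a function such that 1. $\operatorname{reg} I(G)\le f(G)$ for every $G\in\mathcal F$; and 2. for every nonempty graph $G\in\mathcal F$ and every non-isolated vertex $w\in V(G)$, $$f(G-w)\le f(G)\quad\text{and}\quad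 f(G-N_G[w])\le\max\{f(G)-1,\,2\}.$$ Then for every $G\in\mathcal F$ and every integer $s\ge 1$, $$\operatorname{reg} I(G)^s\le 2s+f(G)-2.$$ -/

import Mathlib

open MvPolynomial

universe u v

/-! ### Graded Tor against the residue field, and Castelnuovo-Mumford regularity

`S = MvPolynomial V k` is the standard graded polynomial ring on a finite set `V` of variables.
The Koszul complex `K` on the variables is a graded free resolution of the residue field
`k = S / (X v | v ∈ V)`, so `Tor i (M, k) = H i (M ⊗ K)`, with the internal grading inherited
from `M` and from `K`. -/

namespace Koszul

theorem sum_chain_apply {V k M : Type*} [Fintype V] [Field k] [AddCommGroup M] [Module k M]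
    (i : ℕ) (c : V → (V → k) [⋀^Fin i]→ₗ[k] M) (w : Fin i → V → k) :
    (∑ v, c v) w = ∑ v, c v w :=
  map_sum (⟨⟨fun c : (V → k) [⋀^Fin i]→ₗ[k] M => c w, rfl⟩, fun _ _ => rfl⟩ :
    ((V → k) [⋀^Fin i]→ₗ[k] M) →+ M) c _

section

variable (V k : Type*) [Fintype V] [Field k]
variable (M : Type*) [AddCommGroup M] [Module k M] [Module (MvPolynomial V k) M]
  [IsScalarTower k (MvPolynomial V k) M]

/-- The term `M ⊗ Λ^i` in homological degree `i` of the Koszul complex of `M` on the variables,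
written as `k`-multilinear alternating maps from `k ^ V` to `M`. The coefficient of
`e_{a 0} ∧ ⋯ ∧ e_{a (i-1)}` is the value of the map at the corresponding standard basis vectors. -/
abbrev Chain (i : ℕ) : Type _ := (V → k) [⋀^Fin i]→ₗ[k] M

instance (i : ℕ) : IsScalarTower k (MvPolynomial V k) (Chain V k M i) :=
  ⟨fun r p c => by ext w; simp only [AlternatingMap.smul_apply, smul_assoc]⟩

/-- The Koszul differential: contraction with `∑ v, X v • (e v)^*`, that is
`(∂ c) (w₁, …, wᵢ) = ∑ v, X v • c (e v, w₁, …, wᵢ)`. -/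
noncomputable def d (i : ℕ) : Chain V k M (i + 1) →ₗ[MvPolynomial V k] Chain V k M i where
  toFun c := ∑ v, (X v : MvPolynomial V k) • c.curryLeft (Pi.basisFun k V v)
  map_add' c c' := by
    simp [Finset.sum_add_distrib]
  map_smul' p c := by
    ext w
    simp only [sum_chain_apply, AlternatingMap.smul_apply,
      AlternatingMap.curryLeft_apply_apply, RingHom.id_apply, Finset.smul_sum]
    exact Finset.sum_congr rfl fun v _ => smul_comm _ _ _

theorem d_apply (i : ℕ) (c : Chain V k M (i + 1)) (w : Fin i → V → k) :
    d V k M i c w =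
      ∑ v, (X v : MvPolynomial V k) • c (Matrix.vecCons (Pi.basisFun k V v) w) := by
  simp [d, sum_chain_apply]

/-- Consecutive differentials compose to zero. -/
theorem d_d (i : ℕ) (c : Chain V k M (i + 2)) : d V k M i (d V k M (i + 1) c) = 0 := by
  classical
  ext w
  simp only [d_apply, Finset.smul_sum, AlternatingMap.zero_apply]
  rw [← Finset.sum_product']
  refine Finset.sum_involution (fun p _ => (p.2, p.1)) ?_ ?_ (by simp) (by simp)
  · rintro ⟨u, v⟩ -
    have h := c.map_swap (Matrix.vecCons (Pi.basisFun k V v)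
      (Matrix.vecCons (Pi.basisFun k V u) w)) (i := 0) (j := 1) (by simp)
    have e : (Matrix.vecCons (Pi.basisFun k V v) (Matrix.vecCons (Pi.basisFun k V u) w)) ∘
        (Equiv.swap (0 : Fin (i + 2)) 1) =
        Matrix.vecCons (Pi.basisFun k V u) (Matrix.vecCons (Pi.basisFun k V v) w) := by
      funext j
      refine Fin.cases ?_ (fun j => Fin.cases ?_ (fun j => ?_) j) j
      · simp
      · simp
      · rw [Function.comp_apply, Equiv.swap_apply_of_ne_of_ne (by simp [Fin.ext_iff])
          (by simp [Fin.ext_iff])]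
        simp
    rw [e] at h
    simp only [h, smul_neg]
    rw [smul_smul, smul_smul, mul_comm, add_neg_cancel]
  · rintro ⟨u, v⟩ - hne heq
    obtain rfl : v = u := congrArg Prod.fst heq
    refine hne ?_
    rw [c.map_eq_zero_of_eq _ (i := 0) (j := 1) (by simp) (by simp), smul_zero, smul_zero]

/-- The cycles in homological degree `i`. -/
noncomputable def cycles : (i : ℕ) → Submodule (MvPolynomial V k) (Chain V k M i)
  | 0 => ⊤
  | i + 1 => LinearMap.ker (d V k M i)

/-- The boundaries in homological degree `i`. -/
noncomputable def boundaries (i : ℕ) : Submodule (MvPolynomial V k) (Chain V k M i) :=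
  LinearMap.range (d V k M i)

/-- The module `Tor i (M, k)` over `S = MvPolynomial V k`, as the homology of `M ⊗ K`. -/
abbrev Tor (i : ℕ) : Type _ :=
  cycles V k M i ⧸ (boundaries V k M i).comap (cycles V k M i).subtype

variable {M}

/-- The homogeneous component `Tor i (M, k)_j`, for a module `M` whose homogeneous component of
degree `n` is `𝓜 n`: the classes of the cycles of internal degree `j`. As `Λ^i` sits in internal
degree `i`, these are the cycles with values in `𝓜 (j - i)`. -/
noncomputable def gradedTor (𝓜 : ℤ → Submodule k M) (i : ℕ) (j : ℤ) :
    Submodule k (Tor V k M i) where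
  carrier := {t | ∃ z : cycles V k M i,
    (∀ w, (z : Chain V k M i) w ∈ 𝓜 (j - i)) ∧ Submodule.Quotient.mk z = t}
  zero_mem' := ⟨0, fun w => by simp, rfl⟩
  add_mem' := by
    rintro _ _ ⟨z, hz, rfl⟩ ⟨z', hz', rfl⟩
    exact ⟨z + z', fun w => by simpa using add_mem (hz w) (hz' w), rfl⟩
  smul_mem' := by
    rintro r _ ⟨z, hz, rfl⟩
    exact ⟨r • z, fun w => by simpa using (𝓜 (j - i)).smul_mem r (hz w), rfl⟩

/-- The Castelnuovo-Mumford regularity of a graded module,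
`reg M = max {j - i | Tor i (M, k)_j ≠ 0}`, as an element of `ℤ ∪ {-∞, +∞}`; the zero module has
regularity `-∞`. -/
noncomputable def regularity (𝓜 : ℤ → Submodule k M) : WithBot (WithTop ℤ) :=
  sSup {r | ∃ (i : ℕ) (j : ℤ), gradedTor V k 𝓜 i j ≠ ⊥ ∧ r = ((j - i : ℤ) : WithTop ℤ)}

end

end Koszul

section

variable {V k : Type*} [Fintype V] [Field k]

/-- The homogeneous polynomials of degree `n`, for an integer `n` (only `0` if `n < 0`). -/
noncomputable def homogeneousPart (V k : Type*) [Field k] :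
    ℤ → Submodule k (MvPolynomial V k)
  | Int.ofNat n => homogeneousSubmodule V k n
  | Int.negSucc _ => ⊥

/-- The grading of an ideal `J` of the polynomial ring: the component of degree `n` consists of
the elements of `J` that are homogeneous polynomials of degree `n`. -/
noncomputable def idealGrading (J : Ideal (MvPolynomial V k)) (n : ℤ) : Submodule k J :=
  (homogeneousPart V k n).comap (J.subtype.restrictScalars k)

/-- The Castelnuovo-Mumford regularity of a homogeneous ideal, as a graded module. -/
noncomputable def idealRegularity (J : Ideal (MvPolynomial V k)) : WithBot (WithTop ℤ) :=
  Koszul.regularity V k (idealGrading J)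

end

/-! ### Finite simple graphs, hierarchies, edge ideals -/

/-- A finite simple graph, bundled with its vertex set. -/
structure FiniteGraph where
  /-- The vertex set. -/
  V : Type u
  [finite : Finite V]
  /-- The adjacency relation. -/
  graph : SimpleGraph V

namespace FiniteGraph

noncomputable instance (G : FiniteGraph) : Fintype G.V :=
  @Fintype.ofFinite G.V G.finite

/-- A graph is nonempty if it has an edge. -/
def IsNonempty (G : FiniteGraph) : Prop := G.graph.edgeSet.Nonempty

/-- `G - W`, the induced subgraph on the complement of `W`. -/
def delete (G : FiniteGraph) (W : Set G.V) : FiniteGraph where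
  V := ↥(Wᶜ)
  finite := have := G.finite; inferInstance
  graph := G.graph.induce Wᶜ

/-- The closed neighborhood `N[u]`. -/
def closedNeighborhood (G : FiniteGraph) (u : G.V) : Set G.V :=
  G.graph.neighborSet u ∪ {u}

/-- `G - u`. -/
def deleteVertex (G : FiniteGraph) (u : G.V) : FiniteGraph := G.delete {u}

/-- `G - N[u]`. -/
def deleteClosedNeighborhood (G : FiniteGraph) (u : G.V) : FiniteGraph :=
  G.delete (G.closedNeighborhood u)

/-- A collection of finite simple graphs is a hierarchy if for every nonempty `G` in it and every
vertex `u` of `G`, both `G - u` and `G - N[u]` are in it. -/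
def IsHierarchy (F : Set FiniteGraph) : Prop :=
  ∀ G ∈ F, G.IsNonempty → ∀ u : G.V, G.deleteVertex u ∈ F ∧ G.deleteClosedNeighborhood u ∈ F

/-- The edge ideal `I(G) = ⟨u v | uv ∈ E(G)⟩` in the polynomial ring over `k` whose variables are
the vertices of `G`. -/
noncomputable def edgeIdeal (k : Type*) [Field k] (G : FiniteGraph) :
    Ideal (MvPolynomial G.V k) :=
  Ideal.span {p | ∃ u v : G.V, G.graph.Adj u v ∧ p = X u * X v}

end FiniteGraph

set_option linter.unusedSectionVars false
set_option linter.unusedVariables false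

/-! A monomial ideal is handled through its set of exponents. In multidegree `b` its Koszul homology
is that of the complex of squarefree monomials dividing `x^b` with quotient in the ideal, so a
regularity bound becomes the acyclicity statement `RegLE` (`idealRegularity_le_iff`). Long exact
sequences of these complexes give the two estimates used: through colon and restriction at a
variable (`of_colon_of_erase`), and through removal of one generator (`of_union_Ici`).

To pass from `I^s` to `I^(s+1)`, the generators of `I^s` are removed one at a time,
lexicographically smallest first. Each removal costs the regularity of a colon ideal by a product
`M` of `s` edges, shifted by `2s`. By the exchange property of degree vectors (`exchange`), this
colon is generated by variables and by the products `x_u x_v` of pairs even-connected with respect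
to `M`, squares included. Hence `regLE_powerSet_succ` reduces the theorem to the quadrics of
even-connected pairs.

These have regularity at most `r + 2` with `r = f(G) - 2` (`regLE_quadric_of_good`). Taking the
colon at a vertex `x` leaves variables and the quadric on the vertices not connected to `x`; there,
even-connection is that of an induced subgraph of `G - N[x]` (`evenConn_restrict_iff`), and `r`
drops by one. When `f` has dropped to two, regularity two excludes induced cycles of length at least
four in the complement (`not_isAnticycle_of_regLE`). Even-connection creates no new ones
(`IsAnticycle.of_evenConn`), and a theorem of Dirac type (`exists_cosimplicial`) finds a vertex at
which the colon is generated by variables. -/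

/-! ### Signed boundary operators on functions of finite sets -/

namespace SimplicialKoszul

open Finset

section Sign

variable (k : Type*) [Field k] {V : Type*} [LinearOrder V]

/-- The sign of moving `v` to its place among the elements of `τ`. -/
def sgn (v : V) (τ : Finset V) : k := (-1) ^ (τ.filter (· < v)).card

theorem sgn_mul_self (v : V) (τ : Finset V) : sgn k v τ * sgn k v τ = 1 := by
  rw [sgn, ← mul_pow]; simp

theorem sgn_insert {v w : V} {τ : Finset V} (hw : w ∉ τ) :
    sgn k v (insert w τ) = (if w < v then -1 else 1) * sgn k v τ := by
  unfold sgn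
  rw [filter_insert]
  split_ifs with h
  · rw [card_insert_of_notMem (by simp [hw]), pow_succ, mul_comm]
  · simp

theorem sgn_swap {v w : V} {τ : Finset V} (hv : v ∉ τ) (hw : w ∉ τ) (h : v ≠ w) :
    sgn k v τ * sgn k w (insert v τ) = -(sgn k w τ * sgn k v (insert w τ)) := by
  rw [sgn_insert k hv, sgn_insert k hw]
  rcases lt_or_gt_of_ne h with h | h
  · simp only [h, h.not_gt, if_true, if_false]; ring
  · simp only [h, h.not_gt, if_true, if_false]; ring

end Sign

variable {k : Type*} [Field k] {V : Type*} [LinearOrder V] [Fintype V]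

/-- The boundary operator. -/
def bd (c : Finset V → k) (τ : Finset V) : k := ∑ v ∈ τᶜ, sgn k v τ * c (insert v τ)

theorem bd_add (c c' : Finset V → k) (τ) : bd (c + c') τ = bd c τ + bd c' τ := by
  simp [bd, mul_add, sum_add_distrib]

theorem bd_sub (c c' : Finset V → k) (τ) : bd (c - c') τ = bd c τ - bd c' τ := by
  simp [bd, mul_sub, sum_sub_distrib]

theorem bd_neg (c : Finset V → k) (τ) : bd (-c) τ = -bd c τ := by
  simp [bd]

theorem bd_eq_zero_of_forall {c : Finset V → k} {τ : Finset V}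
    (h : ∀ v ∉ τ, c (insert v τ) = 0) : bd c τ = 0 :=
  sum_eq_zero fun v hv => by rw [h v (by simpa using hv), mul_zero]

theorem bd_congr {c c' : Finset V → k} {τ : Finset V}
    (h : ∀ v ∉ τ, c (insert v τ) = c' (insert v τ)) : bd c τ = bd c' τ :=
  sum_congr rfl fun v hv => by rw [h v (by simpa using hv)]

theorem bd_bd (c : Finset V → k) (τ : Finset V) : bd (bd c) τ = 0 := by
  simp only [bd, mul_sum]
  rw [sum_sigma']
  refine sum_involution (fun p _ => ⟨p.2, p.1⟩) ?_ ?_ ?_ ?_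
  · rintro ⟨v, w⟩ h
    simp only [mem_sigma, mem_compl, mem_insert, not_or] at h
    obtain ⟨hv, hwv, hw⟩ := h
    simp only [← mul_assoc]
    rw [sgn_swap k hv hw (Ne.symm hwv), Finset.insert_comm v w]
    ring
  · rintro ⟨v, w⟩ h _ heq
    simp only [mem_sigma, mem_compl, mem_insert, not_or] at h
    simp only [Sigma.mk.injEq] at heq
    exact h.2.1 heq.1
  · rintro ⟨v, w⟩ h
    simp only [mem_sigma, mem_compl, mem_insert, not_or] at h ⊢
    exact ⟨h.2.2, fun e => h.2.1 e.symm, h.1⟩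
  · rintro ⟨v, w⟩ _; rfl

/-- The cone operator with apex `x`. -/
def cone (x : V) (c : Finset V → k) (τ : Finset V) : k :=
  if x ∈ τ then sgn k x (τ.erase x) * c (τ.erase x) else 0

/-- Coning is a contracting homotopy on the full simplex; every acyclicity below starts from it. -/
theorem bd_cone_add_cone_bd (x : V) (c : Finset V → k) (τ : Finset V) :
    bd (cone x c) τ + cone x (bd c) τ = c τ := by
  by_cases hx : x ∈ τ
  · obtain ⟨ρ, hρ, rfl⟩ : ∃ ρ, x ∉ ρ ∧ insert x ρ = τ :=
      ⟨τ.erase x, notMem_erase x τ, insert_erase hx⟩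
    have e1 : (ρᶜ : Finset V) = insert x (insert x ρ)ᶜ := by
      ext v; simp only [mem_compl, mem_insert]; by_cases h : v = x
      · subst h; simp [hρ]
      · simp [h]
    rw [cone, if_pos hx, erase_insert hρ, bd, bd, e1, sum_insert (by simp), mul_add, ← mul_assoc,
      sgn_mul_self, one_mul, add_comm, add_assoc, mul_sum, ← sum_add_distrib, sum_eq_zero, add_zero]
    intro v hv
    simp only [mem_compl, mem_insert, not_or] at hv
    rw [cone, if_pos (by simp), Finset.insert_comm v x, erase_insert (by simp [hρ, Ne.symm hv.1]),
      ← mul_assoc, ← mul_assoc, ← add_mul]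
    have h1 := sgn_swap k hv.2 hρ hv.1
    have h2 := sgn_mul_self k x ρ
    have h3 := sgn_mul_self k v ρ
    have h4 : sgn k x (insert v ρ) = -(sgn k v ρ * (sgn k x ρ * sgn k v (insert x ρ))) := by
      rw [← mul_neg, ← h1, ← mul_assoc, h3, one_mul]
    have h5 := sgn_mul_self k v (insert x ρ)
    rw [h4]
    convert zero_mul _
    linear_combination (-(sgn k v ρ * sgn k x ρ)) * h5
  · rw [cone, if_neg hx, add_zero, bd, sum_eq_single x]
    · rw [cone, if_pos (by simp), erase_insert hx, ← mul_assoc, sgn_mul_self, one_mul]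
    · intro v hv hvx
      rw [cone, if_neg (by simp [hx, Ne.symm hvx]), mul_zero]
    · intro h; simp [hx] at h

/-- `c` is a chain of sets of `i` elements in `𝒟`. -/
def IsChainOn (𝒟 : Set (Finset V)) (i : ℕ) (c : Finset V → k) : Prop :=
  ∀ τ, c τ ≠ 0 → τ ∈ 𝒟 ∧ τ.card = i

variable (k) in
/-- Exactness, at the sets of `i` elements, of the complex of functions on `𝒟`. -/
def Acyc (𝒟 : Set (Finset V)) (i : ℕ) : Prop :=
  ∀ c : Finset V → k, IsChainOn 𝒟 i c → (∀ τ ∈ 𝒟, bd c τ = 0) →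
    ∃ c' : Finset V → k, IsChainOn 𝒟 (i + 1) c' ∧ ∀ τ ∈ 𝒟, bd c' τ = c τ

/-- The restriction of a chain to `𝒟`. -/
noncomputable def res (𝒟 : Set (Finset V)) (c : Finset V → k) : Finset V → k :=
  𝒟.indicator c

namespace IsChainOn

variable {𝒟 𝒟' : Set (Finset V)} {i : ℕ} {c c' : Finset V → k}

theorem eq_zero (h : IsChainOn 𝒟 i c) {τ} (hτ : τ ∉ 𝒟) : c τ = 0 := by
  by_contra h0; exact hτ (h τ h0).1

theorem eq_zero_of_card (h : IsChainOn 𝒟 i c) {τ : Finset V} (hτ : τ.card ≠ i) : c τ = 0 := by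
  by_contra h0; exact hτ (h τ h0).2

theorem mono (h : IsChainOn 𝒟 i c) (h' : 𝒟 ⊆ 𝒟') : IsChainOn 𝒟' i c :=
  fun τ hτ => ⟨h' (h τ hτ).1, (h τ hτ).2⟩

theorem sub (h : IsChainOn 𝒟 i c) (h' : IsChainOn 𝒟 i c') : IsChainOn 𝒟 i (c - c') := by
  intro τ hτ
  by_cases h0 : c τ = 0
  · exact h' τ fun h1 => hτ (by simp [h0, h1])
  · exact h τ h0

theorem add (h : IsChainOn 𝒟 i c) (h' : IsChainOn 𝒟 i c') : IsChainOn 𝒟 i (c + c') := by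
  intro τ hτ
  by_cases h0 : c τ = 0
  · exact h' τ fun h1 => hτ (by simp [h0, h1])
  · exact h τ h0

theorem neg (h : IsChainOn 𝒟 i c) : IsChainOn 𝒟 i (-c) :=
  fun τ hτ => h τ (by simpa using hτ)

theorem restrict (h : IsChainOn 𝒟 i c) (𝒟') : IsChainOn 𝒟' i (res 𝒟' c) := by
  intro τ hτ
  have := Set.mem_of_indicator_ne_zero hτ
  refine ⟨this, (h τ ?_).2⟩
  rwa [res, Set.indicator_of_mem this] at hτ

theorem res_bd (h : IsChainOn 𝒟' (i + 1) c) (𝒟) : IsChainOn 𝒟 i (res 𝒟 (bd c)) := by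
  intro τ hτ
  have hm := Set.mem_of_indicator_ne_zero hτ
  refine ⟨hm, ?_⟩
  rw [res, Set.indicator_of_mem hm] at hτ
  by_contra hc
  refine hτ (bd_eq_zero_of_forall fun v hv => h.eq_zero_of_card ?_)
  rw [card_insert_of_notMem hv]; omega

/-- Convexity makes the restricted boundary square to zero: if a set above `τ` has left `𝒟`, no
larger set lies in `𝒟` again, so nothing is lost by restricting. -/
theorem bd_res_bd (h : IsChainOn 𝒟 i c) (h𝒟 : 𝒟.OrdConnected) {τ} (hτ : τ ∈ 𝒟) :
    bd (res 𝒟 (bd c)) τ = 0 := by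
  rw [← bd_bd c τ]
  refine bd_congr fun v _ => ?_
  by_cases hm : insert v τ ∈ 𝒟
  · exact Set.indicator_of_mem hm _
  · rw [res, Set.indicator_of_notMem hm]
    refine (bd_eq_zero_of_forall fun w _ => h.eq_zero fun h1 => hm ?_).symm
    exact h𝒟.out hτ h1 ⟨subset_insert _ _, subset_insert _ _⟩

end IsChainOn

theorem acyc_of_isEmpty {𝒟 : Set (Finset V)} {i : ℕ} (h : ∀ τ ∈ 𝒟, τ.card ≠ i) : Acyc k 𝒟 i := by
  intro c hc _
  have : c = 0 := funext fun τ => by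
    by_contra h0; exact h τ (hc τ h0).1 (hc τ h0).2
  exact ⟨0, fun τ h => (h rfl).elim, fun τ _ => by simp [this, bd]⟩

/-! ### Long exact sequences, cones and suspensions. -/

section Exact

variable {𝒟 𝒟₁ 𝒟₂ : Set (Finset V)} {i : ℕ}

/-- The situation of a subcomplex `𝒟₁` of `𝒟` with quotient `𝒟₂`. -/
structure IsExtension (𝒟 𝒟₁ 𝒟₂ : Set (Finset V)) : Prop where
  ordConnected : 𝒟.OrdConnected
  union : 𝒟 = 𝒟₁ ∪ 𝒟₂
  not_le : ∀ σ ∈ 𝒟₁, ∀ τ ∈ 𝒟₂, ¬ τ ⊆ σ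

namespace IsExtension

variable (h : IsExtension 𝒟 𝒟₁ 𝒟₂)
include h

theorem left_subset : 𝒟₁ ⊆ 𝒟 := h.union ▸ Set.subset_union_left

theorem right_subset : 𝒟₂ ⊆ 𝒟 := h.union ▸ Set.subset_union_right

theorem notMem_right {τ} (hτ : τ ∈ 𝒟₁) : τ ∉ 𝒟₂ := fun h' => h.not_le τ hτ τ h' subset_rfl

theorem bd_left {c : Finset V → k} (hc : IsChainOn 𝒟₁ i c) {τ} (hτ : τ ∈ 𝒟₂) : bd c τ = 0 :=
  bd_eq_zero_of_forall fun v _ => hc.eq_zero fun h' => h.not_le _ h' _ hτ (subset_insert _ _)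

theorem bd_res_right {c : Finset V → k} (hc : IsChainOn 𝒟 i c) {τ} (hτ : τ ∈ 𝒟₂) :
    bd (res 𝒟₂ c) τ = bd c τ := by
  refine bd_congr fun v _ => ?_
  by_cases hm : insert v τ ∈ 𝒟₂
  · exact Set.indicator_of_mem hm _
  · rw [res, Set.indicator_of_notMem hm]
    refine (hc.eq_zero fun h1 => ?_).symm
    rw [h.union] at h1
    exact h1.elim (fun h1 => h.not_le _ h1 _ hτ (subset_insert _ _)) hm

/-- Middle term of the long exact sequence: filling the part of a cycle on the quotient leaves a
cycle on the subcomplex. -/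
theorem acyc (h₁ : Acyc k 𝒟₁ i) (h₂ : Acyc k 𝒟₂ i) : Acyc k 𝒟 i := by
  intro c hc hz
  obtain ⟨c₂, hc₂, hb₂⟩ := h₂ (res 𝒟₂ c) (hc.restrict _) fun τ hτ => by
    rw [h.bd_res_right hc hτ, hz τ (h.right_subset hτ)]
  have hc₂' := hc₂.mono h.right_subset
  have hd : IsChainOn 𝒟 i (c - res 𝒟 (bd c₂)) := hc.sub (hc₂'.res_bd _)
  have hd₁ : IsChainOn 𝒟₁ i (c - res 𝒟 (bd c₂)) := by
    intro τ hτ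
    obtain ⟨hm, hcard⟩ := hd τ hτ
    refine ⟨?_, hcard⟩
    have hm' := hm
    rw [h.union] at hm
    refine hm.resolve_right fun h' => hτ ?_
    rw [Pi.sub_apply, res, Set.indicator_of_mem hm', hb₂ τ h', res, Set.indicator_of_mem h',
      sub_self]
  obtain ⟨c₁, hc₁, hb₁⟩ := h₁ _ hd₁ fun τ hτ => by
    rw [bd_sub, hz τ (h.left_subset hτ), hc₂'.bd_res_bd h.ordConnected (h.left_subset hτ), sub_zero]
  refine ⟨c₁ + c₂, (hc₁.mono h.left_subset).add hc₂', fun τ hτ => ?_⟩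
  rw [bd_add]
  have hτ' := hτ
  rw [h.union] at hτ
  rcases hτ with hτ | hτ
  · rw [hb₁ τ hτ, Pi.sub_apply, res, Set.indicator_of_mem hτ', sub_add_cancel]
  · rw [h.bd_left hc₁ hτ, hb₂ τ hτ, res, Set.indicator_of_mem hτ, zero_add]

/-- A filling in the whole complex is a cycle on the quotient; correcting it by a filling there
moves it into the subcomplex. -/
theorem acyc_left (h₀ : Acyc k 𝒟 i) (h₂ : Acyc k 𝒟₂ (i + 1)) : Acyc k 𝒟₁ i := by
  intro c hc hz
  obtain ⟨c', hc', hb'⟩ := h₀ c (hc.mono h.left_subset) fun τ hτ => by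
    rw [h.union] at hτ
    exact hτ.elim (hz τ) (h.bd_left hc)
  obtain ⟨c₂, hc₂, hb₂⟩ := h₂ (res 𝒟₂ c') (hc'.restrict _) fun τ hτ => by
    rw [h.bd_res_right hc' hτ, hb' τ (h.right_subset hτ)]
    exact hc.eq_zero fun h1 => h.notMem_right h1 hτ
  have hc₂' := hc₂.mono h.right_subset
  refine ⟨c' - res 𝒟 (bd c₂), ?_, fun τ hτ => ?_⟩
  · intro τ hτ
    obtain ⟨hm, hcard⟩ := hc'.sub (hc₂'.res_bd _) τ hτ
    refine ⟨?_, hcard⟩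
    have hm' := hm
    rw [h.union] at hm
    refine hm.resolve_right fun h' => hτ ?_
    rw [Pi.sub_apply, res, Set.indicator_of_mem hm', hb₂ τ h', res, Set.indicator_of_mem h',
      sub_self]
  · rw [bd_sub, hb' τ (h.left_subset hτ), hc₂'.bd_res_bd h.ordConnected (h.left_subset hτ),
      sub_zero]

/-- A relative cycle has its boundary in the subcomplex; filling that boundary there turns it into a
cycle of the whole. -/
theorem acyc_right (h₀ : Acyc k 𝒟 (i + 1)) (h₁ : Acyc k 𝒟₁ i) : Acyc k 𝒟₂ (i + 1) := by
  intro c hc hz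
  have hc' := hc.mono h.right_subset
  obtain ⟨c₁, hc₁, hb₁⟩ := h₁ (res 𝒟₁ (bd c)) (hc.res_bd _) fun τ hτ => by
    rw [← hc'.bd_res_bd h.ordConnected (h.left_subset hτ)]
    congr 1
    funext σ
    by_cases hσ : σ ∈ 𝒟₁
    · rw [res, res, Set.indicator_of_mem hσ, Set.indicator_of_mem (h.left_subset hσ)]
    · rw [res, res, Set.indicator_of_notMem hσ]
      by_cases hσ' : σ ∈ 𝒟
      · rw [Set.indicator_of_mem hσ']
        rw [h.union] at hσ'
        exact (hz σ (hσ'.resolve_left hσ)).symm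
      · rw [Set.indicator_of_notMem hσ']
  obtain ⟨c', hc'', hb'⟩ := h₀ (c - c₁) (hc'.sub (hc₁.mono h.left_subset)) fun τ hτ => by
    rw [bd_sub]
    rw [h.union] at hτ
    rcases hτ with hτ | hτ
    · rw [hb₁ τ hτ, res, Set.indicator_of_mem hτ, sub_self]
    · rw [hz τ hτ, h.bd_left hc₁ hτ, sub_zero]
  refine ⟨res 𝒟₂ c', hc''.restrict _, fun τ hτ => ?_⟩
  rw [h.bd_res_right hc'' hτ, hb' τ (h.right_subset hτ), Pi.sub_apply,
    hc₁.eq_zero fun h1 => h.notMem_right h1 hτ, sub_zero]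

end IsExtension

/-- Such a family is a cone with apex `x`, and `cone x` stays inside it. -/
theorem acyc_of_toggle (x : V) (h : ∀ τ, x ∉ τ → (τ ∈ 𝒟 ↔ insert x τ ∈ 𝒟)) (i : ℕ) :
    Acyc k 𝒟 i := by
  have h' : ∀ τ, x ∈ τ → (τ ∈ 𝒟 ↔ τ.erase x ∈ 𝒟) := fun τ hτ => by
    rw [h (τ.erase x) (notMem_erase _ _), insert_erase hτ]
  intro c hc hz
  refine ⟨cone x c, fun τ hτ => ?_, fun τ hτ => ?_⟩
  · by_cases hx : x ∈ τ
    · rw [cone, if_pos hx] at hτ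
      obtain ⟨h1, h2⟩ := hc _ (right_ne_zero_of_mul hτ)
      exact ⟨(h' τ hx).2 h1, by rw [← h2, card_erase_add_one hx]⟩
    · rw [cone, if_neg hx] at hτ
      exact (hτ rfl).elim
  · rw [← bd_cone_add_cone_bd x c τ, left_eq_add, cone]
    split_ifs with hx
    · rw [hz _ ((h' τ hx).1 hτ), mul_zero]
    · rfl

theorem acyc_insert (x : V) (hx : ∀ τ ∈ 𝒟, x ∉ τ) (h : Acyc k 𝒟 i) :
    Acyc k {τ | x ∈ τ ∧ τ.erase x ∈ 𝒟} (i + 1) := by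
  intro c hc hz
  -- Every chain on sets containing `x` is the cone over a chain one size lower. On such sets the
  -- cone anticommutes with the boundary, whence the sign of the filling `-cone x e'`.
  set e : Finset V → k := fun ρ => if x ∈ ρ then 0 else sgn k x ρ * c (insert x ρ) with he
  have hce : c = cone x e := by
    funext τ
    by_cases hτ : x ∈ τ
    · rw [cone, if_pos hτ, he]
      simp only [notMem_erase, if_false, insert_erase hτ]
      rw [← mul_assoc, sgn_mul_self, one_mul]
    · rw [cone, if_neg hτ]
      exact hc.eq_zero fun h1 => hτ h1.1
  have hec : IsChainOn 𝒟 i e := by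
    intro ρ hρ
    rw [he] at hρ
    by_cases hxρ : x ∈ ρ
    · simp [hxρ] at hρ
    · simp only [hxρ, if_false] at hρ
      obtain ⟨⟨-, h1⟩, h2⟩ := hc _ (right_ne_zero_of_mul hρ)
      rw [erase_insert hxρ] at h1
      rw [card_insert_of_notMem hxρ] at h2
      exact ⟨h1, by omega⟩
  obtain ⟨e', he', hb⟩ := h e hec fun ρ hρ => by
    have h1 := bd_cone_add_cone_bd x e (insert x ρ)
    rw [← hce, hz _ ⟨mem_insert_self _ _, by rwa [erase_insert (hx ρ hρ)]⟩, zero_add, cone,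
      if_pos (mem_insert_self _ _), erase_insert (hx ρ hρ),
      hec.eq_zero fun h2 => hx _ h2 (mem_insert_self _ _)] at h1
    have h2 := congrArg (sgn k x ρ * ·) h1
    simpa [← mul_assoc, sgn_mul_self] using h2
  refine ⟨-cone x e', IsChainOn.neg fun τ hτ => ?_, fun τ hτ => ?_⟩
  · by_cases hxτ : x ∈ τ
    · rw [cone, if_pos hxτ] at hτ
      obtain ⟨h1, h2⟩ := he' _ (right_ne_zero_of_mul hτ)
      exact ⟨⟨hxτ, h1⟩, by rw [← h2, card_erase_add_one hxτ]⟩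
    · rw [cone, if_neg hxτ] at hτ
      exact (hτ rfl).elim
  · have h1 := bd_cone_add_cone_bd x e' τ
    rw [he'.eq_zero fun h2 => hx _ h2 hτ.1, cone, if_pos hτ.1, hb _ hτ.2] at h1
    rw [bd_neg, hce, cone, if_pos hτ.1]
    linear_combination -h1

end Exact

end SimplicialKoszul

/-! ### Multigraded Koszul homology of monomial ideals -/

namespace SimplicialKoszul

open Finset

section Faces

variable {V : Type*} [DecidableEq V]

/-- The exponent of the squarefree monomial with support `τ`. -/
noncomputable def ind (τ : Finset V) : V →₀ ℕ := ∑ v ∈ τ, Finsupp.single v 1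

theorem ind_apply (τ : Finset V) (v : V) : ind τ v = if v ∈ τ then 1 else 0 := by
  simp [ind, Finsupp.finsetSum_apply, Finsupp.single_apply]

theorem ind_insert {τ : Finset V} {v : V} (hv : v ∉ τ) :
    ind (insert v τ) = Finsupp.single v 1 + ind τ := by
  rw [ind, sum_insert hv, ind]

theorem degree_ind (τ : Finset V) : (ind τ).degree = τ.card := by
  simp [ind]

theorem ind_le_iff {τ : Finset V} {b : V →₀ ℕ} : ind τ ≤ b ↔ ∀ v ∈ τ, 1 ≤ b v := by
  refine forall_congr' fun v => ?_
  rw [ind_apply]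
  split_ifs with h <;> simp [h]

theorem ind_le_ind {σ τ : Finset V} : ind σ ≤ ind τ ↔ σ ⊆ τ := by
  rw [ind_le_iff]
  refine forall₂_congr fun v _ => ?_
  rw [ind_apply]; split_ifs with h <;> simp [h]

/-- The upper Koszul complex, in degree `b`, of the monomial ideal with set of exponents `U`. -/
def face (U : Set (V →₀ ℕ)) (b : V →₀ ℕ) : Set (Finset V) := {τ | ind τ ≤ b ∧ b - ind τ ∈ U}

theorem isLowerSet_face {U : Set (V →₀ ℕ)} (hU : IsUpperSet U) (b : V →₀ ℕ) :
    IsLowerSet (face U b) := by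
  intro τ σ h hτ
  have h' : ind σ ≤ ind τ := ind_le_ind.2 h
  exact ⟨h'.trans hτ.1, hU (tsub_le_tsub_left h' b) hτ.2⟩

end Faces

variable (k : Type*) [Field k] {V : Type*} [LinearOrder V] [Fintype V]

/-- The regularity of the monomial ideal with set of exponents `U` is at most `r`. -/
def RegLE (U : Set (V →₀ ℕ)) (r : ℤ) : Prop :=
  ∀ (b : V →₀ ℕ) (i : ℕ), r < (b.degree : ℤ) - i → Acyc k (face U b) i

variable {k}

theorem acyc_simplex {b : V →₀ ℕ} (hb : b ≠ 0) (i : ℕ) : Acyc k {τ | ind τ ≤ b} i := by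
  obtain ⟨x, hx⟩ := Finsupp.ne_iff.1 hb
  refine acyc_of_toggle x (fun τ _ => ?_) i
  simp only [Set.mem_ofPred_eq, ind_le_iff, mem_insert, forall_eq_or_imp]
  exact ⟨fun h => ⟨Nat.one_le_iff_ne_zero.2 hx, h⟩, fun h => h.2⟩

/-- For `b = 0` the only face is empty and sits in size `0`, so positive sizes need no condition on
`b`. -/
theorem acyc_simplex_succ (b : V →₀ ℕ) (i : ℕ) : Acyc k {τ | ind τ ≤ b} (i + 1) := by
  by_cases hb : b = 0
  · refine acyc_of_isEmpty fun τ hτ h => ?_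
    have h1 : ind τ ≤ b := hτ
    have := (degree_ind τ).symm
    rw [le_antisymm (hb ▸ h1 : ind τ ≤ 0) zero_le] at this
    simp at this; simp [this] at h
  · exact acyc_simplex hb _

theorem isLowerSet_simplex (b : V →₀ ℕ) : IsLowerSet {τ : Finset V | ind τ ≤ b} :=
  fun _ _ h hτ => (ind_le_ind.2 h).trans hτ

/-! ### Regularity under colon, restriction, and change of generators. -/

namespace RegLE

variable {U : Set (V →₀ ℕ)} {r r' : ℤ}

theorem mono (h : RegLE k U r) (hr : r ≤ r') : RegLE k U r' :=
  fun b i hb => h b i (hr.trans_lt hb)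

theorem empty : RegLE k (∅ : Set (V →₀ ℕ)) r :=
  fun b i _ => acyc_of_isEmpty fun τ hτ => hτ.2.elim

theorem mem_insert_face_iff {x : V} {b : V →₀ ℕ} {τ : Finset V} (hτ : x ∈ τ) (hb : b x = 1) :
    τ ∈ face U b ↔ τ.erase x ∈ face U (b - Finsupp.single x 1) := by
  obtain ⟨ρ, hρ, rfl⟩ : ∃ ρ, x ∉ ρ ∧ insert x ρ = τ :=
    ⟨τ.erase x, notMem_erase x τ, insert_erase hτ⟩
  have hx : Finsupp.single x 1 ≤ b := by simp [hb]
  rw [erase_insert hρ, face, face, Set.mem_ofPred_eq, Set.mem_ofPred_eq, ind_insert hρ,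
    ← tsub_tsub, add_comm, le_tsub_iff_right hx]

theorem notMem_of_mem_face_sub {x : V} {b : V →₀ ℕ} {τ : Finset V} (hb : b x = 1)
    (hτ : ind τ ≤ b - Finsupp.single x 1) : x ∉ τ := by
  intro h
  have := ind_le_iff.1 hτ x h
  simp [hb] at this

theorem degree_sub_single {x : V} {b : V →₀ ℕ} (hx : Finsupp.single x 1 ≤ b) :
    ((b - Finsupp.single x 1).degree : ℤ) = b.degree - 1 := by
  have h : b = (b - Finsupp.single x 1) + Finsupp.single x 1 := (tsub_add_cancel_of_le hx).symm
  conv_rhs => rw [h]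
  simp

/-- The part of the complex in degree `b` that contains `x`, for `b x = 1`. -/
theorem acyc_contains {x : V} {b : V →₀ ℕ} (hb : b x = 1) (h : RegLE k U r) {i : ℕ}
    (hi : r < (b.degree : ℤ) - i) : Acyc k {τ | x ∈ τ ∧ τ ∈ face U b} i := by
  have hx : Finsupp.single x 1 ≤ b := by simp [hb]
  rcases i with _ | i
  · refine acyc_of_isEmpty fun τ hτ h0 => ?_
    rw [card_eq_zero] at h0
    have := hτ.1
    simp [h0] at this
  -- Removing `x` lowers both the degree and the size by one, so their difference is unchanged.
  · have := acyc_insert (k := k) x (fun τ hτ => notMem_of_mem_face_sub hb hτ.1)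
      (h (b - Finsupp.single x 1) i (by rw [degree_sub_single hx]; push_cast at hi; linarith))
    convert this using 1
    ext τ
    simp only [Set.mem_ofPred_eq]
    exact and_congr_right fun hτ => mem_insert_face_iff hτ hb

theorem isExtension_contains {𝒟 : Set (Finset V)} (h𝒟 : 𝒟.OrdConnected) (x : V) :
    IsExtension 𝒟 {τ | x ∉ τ ∧ τ ∈ 𝒟} {τ | x ∈ τ ∧ τ ∈ 𝒟} where
  ordConnected := h𝒟
  union := by ext τ; simp only [Set.mem_union, Set.mem_ofPred_eq]; tauto
  not_le σ hσ τ hτ h := hσ.1 (h hτ.1)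

/-- The regularity of an ideal is bounded through its colon ideal and its restriction. -/
theorem of_colon_of_erase (hU : IsUpperSet U) (x : V)
    (h₁ : RegLE k {m | m + Finsupp.single x 1 ∈ U} (r - 1)) (h₂ : RegLE k {m | m.erase x ∈ U} r) :
    RegLE k U r := by
  intro b i hi
  have erase_of {m : V →₀ ℕ} (h : m x = 0) : m.erase x = m :=
    Finsupp.erase_of_notMem_support (by simp [h])
  rcases Nat.lt_trichotomy (b x) 1 with hb | hb | hb
  -- For `b x = 0` all monomials involved are free of `x`, so only the restriction matters.
  · convert h₂ b i hi using 1
    ext τ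
    refine and_congr_right fun hτ => ?_
    rw [Set.mem_ofPred_eq, erase_of]
    rw [Finsupp.tsub_apply]; omega
  -- For `b x = 1`, a face without `x` leaves one factor `x` in the quotient and is a face for the
  -- colon in degree `b - x`; a face with `x` leaves an `x`-free quotient and is a face for the
  -- restriction.
  · have hx : Finsupp.single x 1 ≤ b := by simp [hb]
    refine (isExtension_contains (isLowerSet_face hU b).ordConnected x).acyc ?_ ?_
    · convert h₁ (b - Finsupp.single x 1) i (by rw [degree_sub_single hx]; linarith) using 1
      ext τ
      simp only [Set.mem_ofPred_eq, face]
      constructor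
      · rintro ⟨h1, h2, h3⟩
        have h4 : ind τ ≤ b - Finsupp.single x 1 := by
          intro v
          have := h2 v
          rw [ind_apply] at this ⊢
          by_cases hv : v = x
          · subst hv; simp [h1]
          · simpa [Finsupp.single_apply, Ne.symm hv] using this
        refine ⟨h4, ?_⟩
        rwa [tsub_right_comm, tsub_add_cancel_of_le]
        intro v
        by_cases hv : v = x
        · subst hv; simp [ind_apply, h1, hb]
        · simp [Ne.symm hv]
      · rintro ⟨h1, h2⟩
        have hxτ := notMem_of_mem_face_sub hb h1
        refine ⟨hxτ, h1.trans tsub_le_self, ?_⟩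
        rwa [tsub_right_comm, tsub_add_cancel_of_le] at h2
        intro v
        by_cases hv : v = x
        · subst hv; simp [ind_apply, hxτ, hb]
        · simp [Ne.symm hv]
    · have := acyc_contains hb h₂ hi
      convert this using 1
      ext τ
      simp only [Set.mem_ofPred_eq, face]
      refine and_congr_right fun hτ => and_congr_right fun hτ' => ?_
      rw [erase_of]
      simp [ind_apply, hτ, hb]
  -- For `b x ≥ 2` a factor `x` survives under every face, so the whole complex is that of the
  -- colon.
  · have hx : Finsupp.single x 1 ≤ b := by simp; omega
    convert h₁ (b - Finsupp.single x 1) i (by rw [degree_sub_single hx]; linarith) using 1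
    ext τ
    simp only [Set.mem_ofPred_eq, face]
    have h5 : ∀ v, ind τ v ≤ 1 := fun v => by rw [ind_apply]; split_ifs <;> simp
    have h6 : ind τ ≤ b - Finsupp.single x 1 ↔ ind τ ≤ b := by
      refine ⟨fun h => h.trans tsub_le_self, fun h v => ?_⟩
      have h7 := h5 v
      have h8 := h v
      by_cases hv : v = x
      · subst hv; simp; omega
      · simpa [Finsupp.single_apply, Ne.symm hv] using h8
    rw [h6]
    refine and_congr_right fun hτ => ?_
    rw [tsub_right_comm, tsub_add_cancel_of_le]
    intro v
    have h7 := h5 x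
    by_cases hv : v = x
    · subst hv; simp; omega
    · simp [Ne.symm hv]

/-- Adding a variable to a monomial ideal. -/
theorem union_variable (hU : IsUpperSet U) (x : V) (hr : 1 ≤ r) (h : RegLE k U r) :
    RegLE k (U ∪ {m | m x ≠ 0}) r := by
  have hU' : IsUpperSet (U ∪ {m : V →₀ ℕ | m x ≠ 0}) := by
    refine hU.union fun m m' hm h => ?_
    have := hm x
    simp only [Set.mem_ofPred_eq] at h ⊢
    omega
  intro b i hi
  rcases Nat.lt_trichotomy (b x) 1 with hb | hb | hb
  · convert h b i hi using 1
    ext τ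
    refine and_congr_right fun hτ => or_iff_left ?_
    simp; omega
  · have hx : Finsupp.single x 1 ≤ b := by simp [hb]
    refine (isExtension_contains (isLowerSet_face hU' b).ordConnected x).acyc ?_ ?_
    · have h1 : {τ | x ∉ τ ∧ τ ∈ face (U ∪ {m : V →₀ ℕ | m x ≠ 0}) b} =
          {τ | ind τ ≤ b - Finsupp.single x 1} := by
        ext τ
        simp only [Set.mem_ofPred_eq, face]
        constructor
        · rintro ⟨h1, h2, h3⟩ v
          have := h2 v
          by_cases hv : v = x
          · subst hv; simp [ind_apply, h1]
          · simpa [Finsupp.single_apply, Ne.symm hv] using this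
        · intro h1
          have hxτ := notMem_of_mem_face_sub hb h1
          refine ⟨hxτ, h1.trans tsub_le_self, Or.inr ?_⟩
          simp [ind_apply, hxτ, hb]
      rw [h1]
      rcases i with _ | i
      -- The simplex fails to be acyclic only for `b = x` in size `0`, the generator `x` itself; `1
      -- ≤ r` excludes it.
      · refine acyc_simplex (fun h0 => ?_) 0
        have := degree_sub_single hx
        rw [h0] at this
        simp at this hi
        linarith
      · exact acyc_simplex_succ _ _
    · convert acyc_contains hb h hi using 1
      ext τ
      simp only [Set.mem_ofPred_eq, face]
      refine and_congr_right fun hτ => and_congr_right fun hτ' => or_iff_left ?_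
      simp [ind_apply, hτ, hb]
  · have h1 : face (U ∪ {m : V →₀ ℕ | m x ≠ 0}) b = {τ | ind τ ≤ b} := by
      ext τ
      refine and_iff_left_of_imp fun _ => Or.inr ?_
      simp only [Set.mem_ofPred_eq, Finsupp.tsub_apply, ind_apply]
      split_ifs <;> omega
    rw [h1]
    exact acyc_simplex (fun h0 => by simp [h0] at hb) _

theorem union_variables (hU : IsUpperSet U) (hr : 1 ≤ r) (h : RegLE k U r) (T : Finset V) :
    RegLE k (U ∪ {m | ∃ x ∈ T, m x ≠ 0}) r := by
  have key : ∀ T : Finset V, IsUpperSet (U ∪ {m | ∃ x ∈ T, m x ≠ 0}) := by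
    intro T
    refine hU.union ?_
    rintro m m' hm ⟨x, hx, h⟩
    exact ⟨x, hx, by have := hm x; omega⟩
  induction T using Finset.induction_on with
  | empty => simpa using h
  | insert x T hx ih =>
    convert union_variable (key T) x hr ih using 1
    ext m
    simp only [mem_insert, exists_eq_or_imp, Set.mem_union, Set.mem_ofPred_eq]
    rw [or_assoc, or_comm (a := m x ≠ 0)]

/-- Removing a generator `m` from a monomial ideal. -/
theorem of_union_Ici (hU : IsUpperSet U) (m : V →₀ ℕ) (h₁ : RegLE k (U ∪ Set.Ici m) r)
    (h₂ : RegLE k {n | n + m ∈ U} (r - m.degree)) : RegLE k U r := by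
  intro b i hi
  -- The quotient of the enlarged ideal by the ideal is `S` modulo the colon by `m`, shifted by `m`.
  have hext : IsExtension (face (U ∪ Set.Ici m) b) (face U b)
      {τ | ind τ ≤ b ∧ b - ind τ ∉ U ∧ m ≤ b - ind τ} := by
    refine ⟨(isLowerSet_face (hU.union (isUpperSet_Ici m)) b).ordConnected, ?_, ?_⟩
    · ext τ
      simp only [face, Set.mem_ofPred_eq, Set.mem_union, Set.mem_Ici]
      tauto
    · rintro σ hσ τ hτ h
      exact hτ.2.1 ((isLowerSet_face hU b) h hσ).2
  refine hext.acyc_left (h₁ b i hi) ?_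
  by_cases hm : m ≤ b
  swap
  · exact acyc_of_isEmpty fun τ hτ => (hm (hτ.2.2.trans tsub_le_self)).elim
  have hU' : IsUpperSet {n | n + m ∈ U} := fun n n' hn h => hU (by gcongr) h
  -- The same quotient, now read as the full simplex in degree `b - m` modulo the complex of the
  -- colon.
  have hext' : IsExtension {τ | ind τ ≤ b - m} (face {n | n + m ∈ U} (b - m))
      {τ | ind τ ≤ b ∧ b - ind τ ∉ U ∧ m ≤ b - ind τ} := by
    have h3 : ∀ τ, ind τ ≤ b - m → b - m - ind τ + m = b - ind τ := by
      intro τ h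
      rw [tsub_right_comm, tsub_add_cancel_of_le]
      exact (le_tsub_iff_left (h.trans tsub_le_self)).2
        (by simpa [add_comm] using (le_tsub_iff_right hm).1 h)
    refine ⟨(isLowerSet_simplex _).ordConnected, ?_, ?_⟩
    · ext τ
      simp only [face, Set.mem_ofPred_eq, Set.mem_union]
      have h4 : ind τ ≤ b - m ↔ ind τ ≤ b ∧ m ≤ b - ind τ := by
        constructor
        · intro h
          have h5 := h.trans tsub_le_self
          exact ⟨h5, (le_tsub_iff_left h5).2 ((le_tsub_iff_right hm).1 h)⟩
        · rintro ⟨h5, h6⟩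
          exact (le_tsub_iff_right hm).2 ((le_tsub_iff_left h5).1 h6)
      constructor
      · intro h
        rw [h3 τ h]
        have := h4.1 h
        tauto
      · rintro (h | h)
        · exact h.1
        · exact h4.2 ⟨h.1, h.2.2⟩
    · rintro σ hσ τ hτ h
      have h5 := (isLowerSet_face hU' (b - m)) h hσ
      have h6 : b - m - ind τ + m ∈ U := h5.2
      rw [h3 τ h5.1] at h6
      exact hτ.2.1 h6
  refine hext'.acyc_right (acyc_simplex_succ _ _) (h₂ _ _ ?_)
  have h7 : b.degree = (b - m).degree + m.degree := by
    rw [← map_add, tsub_add_cancel_of_le hm]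
  rw [h7] at hi
  push_cast at hi
  linarith

end RegLE

end SimplicialKoszul

/-! ### Comparison with the Koszul complex -/

namespace SimplicialKoszul

open Finset

variable {k : Type*} [Field k] {V : Type*} [LinearOrder V] [Fintype V]

variable (k) in
/-- The standard basis vectors with index in `σ`, in increasing order. -/
noncomputable def basisTuple (σ : Finset V) {i : ℕ} (h : σ.card = i) : Fin i → V → k :=
  fun t => Pi.basisFun k V (σ.orderEmbOfFin h t)

theorem card_filter_lt_orderEmbOfFin (σ : Finset V) {i : ℕ} (h : σ.card = i) (p : Fin i) :
    (σ.filter (· < σ.orderEmbOfFin h p)).card = p := by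
  have : σ.filter (· < σ.orderEmbOfFin h p) = (Iio p).map (σ.orderEmbOfFin h).toEmbedding := by
    ext v
    simp only [mem_filter, mem_map, mem_Iio, RelEmbedding.coe_toEmbedding]
    constructor
    · rintro ⟨hv, hlt⟩
      rw [← mem_coe, ← range_orderEmbOfFin σ h] at hv
      obtain ⟨t, rfl⟩ := hv
      exact ⟨t, by simpa using hlt, rfl⟩
    · rintro ⟨t, ht, rfl⟩
      exact ⟨orderEmbOfFin_mem _ _ _, by simpa using ht⟩
  rw [this, card_map, Fin.card_Iio]

/-! ### Alternating maps evaluated on sorted basis tuples. -/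

section Alternating

variable {M : Type*} [AddCommGroup M] [Module k M]

/-- Sorting `v` into place passes it over the smaller elements of `σ`, whose number is the exponent
in `sgn`. -/
theorem map_vecCons_basisTuple {i : ℕ} (z : (V → k) [⋀^Fin (i + 1)]→ₗ[k] M) {σ : Finset V}
    (h : σ.card = i) {v : V} (hv : v ∉ σ) (h' : (insert v σ).card = i + 1) :
    z (Matrix.vecCons (Pi.basisFun k V v) (basisTuple k σ h)) =
      sgn k v σ • z (basisTuple k (insert v σ) h') := by
  obtain ⟨p, hp⟩ : ∃ p, (insert v σ).orderEmbOfFin h' p = v := by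
    have : v ∈ Set.range ((insert v σ).orderEmbOfFin h') := by simp
    exact this
  have e1 : (fun t => (insert v σ).orderEmbOfFin h' (p.succAbove t)) = σ.orderEmbOfFin h := by
    refine orderEmbOfFin_unique h (fun t => ?_) ?_
    · have h1 := orderEmbOfFin_mem (insert v σ) h' (p.succAbove t)
      refine (mem_insert.1 h1).resolve_left fun h2 => ?_
      exact p.succAbove_ne t (((insert v σ).orderEmbOfFin h').injective (h2.trans hp.symm))
    · exact ((insert v σ).orderEmbOfFin h').strictMono.comp (Fin.strictMono_succAbove p)
  have e2 : basisTuple k (insert v σ) h' =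
      p.insertNth (α := fun _ => V → k) (Pi.basisFun k V v) (basisTuple k σ h) := by
    rw [Fin.eq_insertNth_iff]
    refine ⟨by rw [basisTuple, hp], ?_⟩
    funext t
    rw [Fin.removeNth, basisTuple, basisTuple, ← e1]
  have e3 : sgn k v σ = (-1) ^ (p : ℕ) := by
    rw [sgn, ← card_filter_lt_orderEmbOfFin (insert v σ) h' p, hp, filter_insert,
      if_neg (lt_irrefl v)]
  rw [e2, AlternatingMap.map_insertNth, e3]
  have : ((-1 : ℤ) ^ (p : ℕ)) • z (Matrix.vecCons (Pi.basisFun k V v) (basisTuple k σ h)) =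
      ((-1 : k) ^ (p : ℕ)) • z (Matrix.vecCons (Pi.basisFun k V v) (basisTuple k σ h)) := by
    rw [← Int.cast_smul_eq_zsmul k]; simp
  rw [this, smul_smul, ← mul_pow]
  simp

theorem map_vecCons_basisTuple_of_mem {i : ℕ} (z : (V → k) [⋀^Fin (i + 1)]→ₗ[k] M) {σ : Finset V}
    (h : σ.card = i) {v : V} (hv : v ∈ σ) :
    z (Matrix.vecCons (Pi.basisFun k V v) (basisTuple k σ h)) = 0 := by
  rw [← mem_coe, ← range_orderEmbOfFin σ h] at hv
  obtain ⟨t, rfl⟩ := hv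
  refine z.map_eq_zero_of_eq _ (i := 0) (j := t.succ) ?_ (Fin.succ_ne_zero t).symm
  simp [basisTuple]

theorem ext_basisTuple {i : ℕ} {z z' : (V → k) [⋀^Fin i]→ₗ[k] M}
    (h : ∀ (σ : Finset V) (hσ : σ.card = i), z (basisTuple k σ hσ) = z' (basisTuple k σ hσ)) :
    z = z' := by
  refine (Pi.basisFun k V).ext_alternating fun a ha => ?_
  have hc : (univ.image a).card = i := by
    rw [card_image_of_injective _ ha, card_univ, Fintype.card_fin]
  have hb : ∀ t, ∃ t', (univ.image a).orderEmbOfFin hc t' = a t := fun t => by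
    have : a t ∈ Set.range ((univ.image a).orderEmbOfFin hc) := by simp
    exact this
  choose e he using hb
  have hinj : Function.Injective e := fun s t hst => ha (by rw [← he, ← he, hst])
  let π : Equiv.Perm (Fin i) := Equiv.ofBijective e (Finite.injective_iff_bijective.1 hinj)
  have h1 : (fun t => Pi.basisFun k V (a t)) = basisTuple k _ hc ∘ π := by
    funext t
    simp [basisTuple, π, he]
  rw [h1, AlternatingMap.map_perm, AlternatingMap.map_perm, h]

/-- The alternating form dual to the basis vectors with index in `τ`. -/
noncomputable def dualForm (k : Type*) [Field k] (τ : Finset V) {i : ℕ} (h : τ.card = i) :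
    (V → k) [⋀^Fin i]→ₗ[k] k :=
  Matrix.detRowAlternating.compLinearMap (LinearMap.funLeft k k (τ.orderEmbOfFin h))

theorem dualForm_self (τ : Finset V) {i : ℕ} (h : τ.card = i) :
    dualForm k τ h (basisTuple k τ h) = 1 := by
  have : (fun t => LinearMap.funLeft k k (τ.orderEmbOfFin h) (basisTuple k τ h t)) =
      (1 : Matrix (Fin i) (Fin i) k) := by
    ext s t
    simp [basisTuple, LinearMap.funLeft_apply, Matrix.one_apply, Pi.single_apply, eq_comm]
  rw [dualForm, AlternatingMap.compLinearMap_apply, this]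
  exact Matrix.det_one

theorem dualForm_of_ne {σ τ : Finset V} {i : ℕ} (h : τ.card = i) (h' : σ.card = i) (hne : σ ≠ τ) :
    dualForm k τ h (basisTuple k σ h') = 0 := by
  obtain ⟨v, hv, hvτ⟩ : ∃ v ∈ σ, v ∉ τ := by
    by_contra! hc
    exact hne (eq_of_subset_of_card_le hc (by omega))
  rw [← mem_coe, ← range_orderEmbOfFin σ h'] at hv
  obtain ⟨s, rfl⟩ := hv
  rw [dualForm, AlternatingMap.compLinearMap_apply]
  refine Matrix.det_eq_zero_of_row_eq_zero s fun t => ?_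
  rw [LinearMap.funLeft_apply, basisTuple, Pi.basisFun_apply, Pi.single_apply, if_neg]
  rintro h1
  exact hvτ (h1 ▸ orderEmbOfFin_mem _ _ _)

end Alternating

theorem gradedTor_eq_bot_iff {V k M : Type*} [Fintype V] [Field k] [AddCommGroup M] [Module k M]
    [Module (MvPolynomial V k) M] [IsScalarTower k (MvPolynomial V k) M] {𝓜 : ℤ → Submodule k M}
    {i : ℕ} {j : ℤ} :
    Koszul.gradedTor V k 𝓜 i j = ⊥ ↔
      ∀ z ∈ Koszul.cycles V k M i, (∀ w, z w ∈ 𝓜 (j - i)) → z ∈ Koszul.boundaries V k M i := by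
  rw [Submodule.eq_bot_iff]
  constructor
  · intro h z hz hw
    have := h (Submodule.Quotient.mk ⟨z, hz⟩) ⟨⟨z, hz⟩, hw, rfl⟩
    rw [Submodule.Quotient.mk_eq_zero] at this
    exact this
  · rintro h _ ⟨z, hz, rfl⟩
    rw [Submodule.Quotient.mk_eq_zero]
    exact h z z.2 hz

/-! ### Multigraded components of Koszul chains. -/

section Compare

variable {J : Ideal (MvPolynomial V k)}

/-- The component of multidegree `b` of a Koszul chain. -/
noncomputable def component (b : V →₀ ℕ) {i : ℕ} (z : Koszul.Chain V k J i) (τ : Finset V) : k :=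
  if h : τ.card = i ∧ ind τ ≤ b then
    coeff (b - ind τ) (z (basisTuple k τ h.1) : MvPolynomial V k) else 0

theorem d_basisTuple {i : ℕ} (z : Koszul.Chain V k J (i + 1)) {σ : Finset V} (h : σ.card = i) :
    (Koszul.d V k J i z (basisTuple k σ h) : MvPolynomial V k) =
      ∑ v ∈ σᶜ.attach, sgn k v.1 σ • ((X v.1 : MvPolynomial V k) *
        (z (basisTuple k (insert v.1 σ) (by
          rw [card_insert_of_notMem (mem_compl.1 v.2), h])) : MvPolynomial V k)) := by
  rw [Koszul.d_apply]
  rw [← sum_subset (subset_univ σᶜ), ← sum_attach, Submodule.coe_sum]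
  · refine sum_congr rfl fun v _ => ?_
    rw [map_vecCons_basisTuple z h (mem_compl.1 v.2)
      (by rw [card_insert_of_notMem (mem_compl.1 v.2), h]), smul_comm]
    simp
  · intro v _ hv
    rw [map_vecCons_basisTuple_of_mem z h (by simpa using hv), smul_zero]

/-- The factor `X v` in the differential compensates for the index `v` that it removes, so the
multidegree is preserved. -/
theorem component_d {i : ℕ} (z : Koszul.Chain V k J (i + 1)) {b : V →₀ ℕ} {σ : Finset V}
    (hσ : σ.card = i) (hb : ind σ ≤ b) :
    component b (Koszul.d V k J i z) σ = bd (component b z) σ := by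
  rw [component, dif_pos ⟨hσ, hb⟩, d_basisTuple, bd, ← sum_attach (σᶜ), coeff_sum]
  refine sum_congr rfl fun v _ => ?_
  have hv := mem_compl.1 v.2
  have hc : (insert v.1 σ).card = i + 1 := by rw [card_insert_of_notMem hv, hσ]
  rw [coeff_smul, smul_eq_mul, coeff_X_mul']
  congr 1
  by_cases h1 : 1 ≤ b v
  · have h2 : ind (insert v.1 σ) ≤ b := by
      rw [ind_le_iff] at hb ⊢
      simpa [h1] using hb
    rw [component, dif_pos ⟨hc, h2⟩, if_pos]
    · congr 1
      rw [ind_insert hv, tsub_tsub, add_comm]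
    · simp [ind_apply, hv]; omega
  · have h2 : ¬ ind (insert v.1 σ) ≤ b := by
      rw [ind_le_iff]
      simp [h1]
    rw [component, dif_neg (by tauto), if_neg]
    simp [ind_apply, hv]; omega

variable (J) in
/-- The Koszul chain of multidegree `b` with the given coefficients. -/
noncomputable def toChain {U : Set (V →₀ ℕ)} (hJ : ∀ p, p ∈ J ↔ ∀ m ∈ p.support, m ∈ U)
    (b : V →₀ ℕ) (i : ℕ) (c : Finset V → k) : Koszul.Chain V k J i :=
  open Classical in
  ∑ τ : {τ : Finset V // τ.card = i},
    (LinearMap.toSpanSingleton k J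
      (if h : b - ind τ.1 ∈ U then ⟨monomial (b - ind τ.1) (c τ), (hJ _).2 fun m hm => by
        rwa [Finset.mem_singleton.1 (support_monomial_subset hm)]⟩ else 0)).compAlternatingMap
      (dualForm k τ.1 τ.2)

variable {U : Set (V →₀ ℕ)} (hJ : ∀ p, p ∈ J ↔ ∀ m ∈ p.support, m ∈ U)

theorem sum_alternating_apply {ι M : Type*} [AddCommGroup M] [Module k M] {i : ℕ} (s : Finset ι)
    (c : ι → (V → k) [⋀^Fin i]→ₗ[k] M) (w : Fin i → V → k) : (∑ t ∈ s, c t) w = ∑ t ∈ s, c t w :=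
  map_sum (⟨⟨fun c : (V → k) [⋀^Fin i]→ₗ[k] M => c w, rfl⟩, fun _ _ => rfl⟩ :
    ((V → k) [⋀^Fin i]→ₗ[k] M) →+ M) c _

theorem toChain_apply {b : V →₀ ℕ} {i : ℕ} {c : Finset V → k} (hc : IsChainOn (face U b) i c)
    {σ : Finset V} (hσ : σ.card = i) :
    (toChain J hJ b i c (basisTuple k σ hσ) : MvPolynomial V k) = monomial (b - ind σ) (c σ) := by
  rw [toChain, sum_alternating_apply, sum_eq_single ⟨σ, hσ⟩]
  · rw [LinearMap.compAlternatingMap_apply, dualForm_self, LinearMap.toSpanSingleton_apply, one_smul]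
    split_ifs with h
    · rfl
    · rw [hc.eq_zero fun h' => h h'.2]; simp
  · intro τ _ hne
    rw [LinearMap.compAlternatingMap_apply, dualForm_of_ne _ _ fun h => hne (Subtype.ext h.symm),
      map_zero]
  · simp

theorem toChain_mem {b : V →₀ ℕ} {i : ℕ} {c : Finset V → k} (hc : IsChainOn (face U b) i c)
    (w : Fin i → V → k) :
    toChain J hJ b i c w ∈ idealGrading J ((b.degree : ℤ) - i) := by
  rw [toChain, sum_alternating_apply]
  refine Submodule.sum_mem _ fun τ _ => ?_
  rw [LinearMap.compAlternatingMap_apply, LinearMap.toSpanSingleton_apply]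
  refine Submodule.smul_mem _ _ ?_
  by_cases h0 : c τ = 0
  · convert Submodule.zero_mem _
    split_ifs
    · ext1; simp [h0]
    · rfl
  · obtain ⟨⟨h1, h2⟩, h3⟩ := hc _ h0
    have h4 : (b.degree : ℤ) - i = ((b - ind τ.1).degree : ℕ) := by
      conv_lhs => rw [← tsub_add_cancel_of_le h1, map_add, degree_ind, h3]
      push_cast; ring
    rw [dif_pos h2, h4]
    exact (mem_homogeneousSubmodule _ _).2 (isHomogeneous_monomial _ rfl)

theorem d_toChain {b : V →₀ ℕ} {i : ℕ} {c : Finset V → k} (hc : IsChainOn (face U b) (i + 1) c)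
    {σ : Finset V} (hσ : σ.card = i) :
    (Koszul.d V k J i (toChain J hJ b (i + 1) c) (basisTuple k σ hσ) : MvPolynomial V k) =
      monomial (b - ind σ) (bd c σ) := by
  rw [d_basisTuple, bd, ← sum_attach (σᶜ), map_sum]
  refine sum_congr rfl fun v _ => ?_
  have hv := mem_compl.1 v.2
  rw [toChain_apply hJ hc]
  by_cases h0 : c (insert v.1 σ) = 0
  · simp [h0]
  · have h1 := (hc _ h0).1.1
    rw [X, monomial_mul, one_mul, smul_monomial, smul_eq_mul]
    congr 2
    rw [ind_insert hv] at h1 ⊢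
    rw [← tsub_tsub, tsub_right_comm, add_tsub_cancel_of_le]
    exact (le_tsub_iff_right (le_of_add_le_right h1)).2 h1

include hJ in
theorem component_isChainOn (b : V →₀ ℕ) {i : ℕ} (z : Koszul.Chain V k J i) :
    IsChainOn (face U b) i (component b z) := by
  intro τ hτ
  rw [component] at hτ
  split_ifs at hτ with h
  · exact ⟨⟨h.2, (hJ _).1 (z _).2 _ (mem_support_iff.2 hτ)⟩, h.1⟩
  · exact (hτ rfl).elim

include hJ in
-- A cycle of internal degree `j` is the sum of its components of multidegrees `b` with total degree
-- `j`; each is filled simplicially and the fillings are added.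
theorem gradedTor_eq_bot (hU : IsUpperSet U) {i : ℕ} {j : ℤ}
    (h : ∀ b : V →₀ ℕ, (b.degree : ℤ) = j → Acyc k (face U b) i) :
    Koszul.gradedTor V k (idealGrading J) i j = ⊥ := by
  rw [gradedTor_eq_bot_iff]
  intro z hz hw
  by_cases hneg : j - i < 0
  · have : z = 0 := by
      ext1 w
      obtain ⟨m, hm⟩ := Int.eq_negSucc_of_lt_zero hneg
      have := hw w
      rw [hm] at this
      exact Subtype.ext ((Submodule.mem_bot k).1 this)
    rw [this]; exact Submodule.zero_mem _
  obtain ⟨n, hn⟩ := Int.eq_ofNat_of_zero_le (not_lt.1 hneg)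
  have hhom : ∀ w, (z w : MvPolynomial V k).IsHomogeneous n := by
    intro w
    have := hw w
    rw [hn] at this
    exact (mem_homogeneousSubmodule _ _).1 this
  have hex : ∀ b : V →₀ ℕ, ∃ c' : Finset V → k, IsChainOn (face U b) (i + 1) c' ∧
      ((b.degree : ℤ) = j → ∀ τ ∈ face U b, bd c' τ = component b z τ) := by
    intro b
    by_cases hb : (b.degree : ℤ) = j
    · obtain ⟨c', h1, h2⟩ := h b hb (component b z) (component_isChainOn hJ b z) fun τ hτ => by
        rcases i with _ | i
        · exact bd_eq_zero_of_forall fun v hv =>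
            (component_isChainOn hJ b z).eq_zero_of_card (by simp)
        · by_cases hc : τ.card = i
          · rw [← component_d z hc hτ.1, show Koszul.d V k J i z = 0 from hz, component]
            split_ifs <;> simp
          · refine bd_eq_zero_of_forall fun v hv =>
              (component_isChainOn hJ b z).eq_zero_of_card ?_
            rw [card_insert_of_notMem hv]; omega
      exact ⟨c', h1, fun _ => h2⟩
    · exact ⟨0, fun τ h => (h rfl).elim, fun h => (hb h).elim⟩
  choose c' hc' hb' using hex
  -- The sum runs over the finitely many multidegrees of total degree `n + i = j`.
  refine ⟨∑ b ∈ univ.finsuppAntidiag (n + i), toChain J hJ b (i + 1) (c' b), ?_⟩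
  rw [map_sum]
  refine ext_basisTuple fun σ hσ => Subtype.ext ?_
  rw [sum_alternating_apply, Submodule.coe_sum]
  simp only [d_toChain hJ (hc' _) hσ]
  have hface : ∀ b, bd (c' b) σ ≠ 0 → σ ∈ face U b := fun b h0 => by
    by_contra hσ'
    exact h0 (bd_eq_zero_of_forall fun v hv => (hc' b).eq_zero fun h2 =>
      hσ' (isLowerSet_face hU b (subset_insert v σ) h2))
  ext m
  have hdeg : (m + ind σ).degree = m.degree + i := by rw [map_add, degree_ind, hσ]
  have hmem : ∀ b : V →₀ ℕ, b ∈ (univ : Finset V).finsuppAntidiag (n + i) ↔ b.degree = n + i :=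
    fun b => by
      rw [mem_finsuppAntidiag, Finsupp.degree_eq_sum]
      simp
  rw [coeff_sum]
  simp only [coeff_monomial]
  have hother : ∀ b ∈ (univ : Finset V).finsuppAntidiag (n + i), b ≠ m + ind σ →
      (if b - ind σ = m then bd (c' b) σ else 0) = 0 := fun b _ hne => by
    split_ifs with h1
    · by_contra h0
      exact hne (by rw [← h1, tsub_add_cancel_of_le (hface b h0).1])
    · rfl
  by_cases hm : m.degree = n
  · rw [sum_eq_single_of_mem (m + ind σ) ((hmem _).2 (by rw [hdeg, hm])) hother,
      add_tsub_cancel_right, if_pos rfl]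
    have hcomp : component (m + ind σ) z σ = coeff m (z (basisTuple k σ hσ) : MvPolynomial V k) := by
      rw [component, dif_pos ⟨hσ, le_add_self⟩, add_tsub_cancel_right]
    rw [← hcomp]
    by_cases hσ' : σ ∈ face U (m + ind σ)
    · exact hb' _ (by rw [hdeg, hm]; push_cast; linarith) σ hσ'
    · rw [(component_isChainOn hJ _ z).eq_zero hσ']
      by_contra h0
      exact hσ' (hface _ h0)
  · have h1 : coeff m (z (basisTuple k σ hσ) : MvPolynomial V k) = 0 := by
      by_contra h0
      exact hm (by rw [Finsupp.degree_eq_weight_one]; exact hhom _ h0)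
    rw [h1]
    refine sum_eq_zero fun b hb => hother b hb fun h2 => hm ?_
    rw [hmem, h2, hdeg] at hb
    omega

include hJ in
-- A simplicial cycle becomes a Koszul cycle of multidegree `b`; the component of multidegree `b` of
-- a Koszul filling fills it.
theorem acyc_of_gradedTor_eq_bot (hU : IsUpperSet U) {i : ℕ} {b : V →₀ ℕ}
    (h : Koszul.gradedTor V k (idealGrading J) i b.degree = ⊥) : Acyc k (face U b) i := by
  rw [gradedTor_eq_bot_iff] at h
  intro c hc hz
  obtain ⟨y, hy⟩ := h (toChain J hJ b i c) (by
    rcases i with _ | i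
    · exact Submodule.mem_top
    · refine ext_basisTuple fun σ hσ => Subtype.ext ?_
      rw [d_toChain hJ hc hσ]
      by_cases hσ' : σ ∈ face U b
      · rw [hz σ hσ']; simp
      · rw [bd_eq_zero_of_forall fun v hv => hc.eq_zero fun h2 =>
          hσ' (isLowerSet_face hU b (subset_insert v σ) h2)]
        simp) (toChain_mem hJ hc)
  refine ⟨component b y, component_isChainOn hJ b y, fun τ hτ => ?_⟩
  by_cases hcard : τ.card = i
  · rw [← component_d y hcard hτ.1, hy, component, dif_pos ⟨hcard, hτ.1⟩, toChain_apply hJ hc]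
    simp
  · rw [hc.eq_zero_of_card hcard]
    refine bd_eq_zero_of_forall fun v hv => (component_isChainOn hJ b y).eq_zero_of_card ?_
    rw [card_insert_of_notMem hv]; omega

include hJ in
theorem idealRegularity_le_iff (hU : IsUpperSet U) {r : ℤ} :
    idealRegularity J ≤ ((r : WithTop ℤ) : WithBot (WithTop ℤ)) ↔ RegLE k U r := by
  have key : idealRegularity J ≤ ((r : WithTop ℤ) : WithBot (WithTop ℤ)) ↔
      ∀ (i : ℕ) (j : ℤ), r < j - i → Koszul.gradedTor V k (idealGrading J) i j = ⊥ := by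
    rw [idealRegularity, Koszul.regularity, sSup_le_iff]
    constructor
    · intro h i j hij
      by_contra h0
      have := h _ ⟨i, j, h0, rfl⟩
      rw [WithBot.coe_le_coe, WithTop.coe_le_coe] at this
      omega
    · rintro h _ ⟨i, j, h0, rfl⟩
      rw [WithBot.coe_le_coe, WithTop.coe_le_coe]
      by_contra h1
      exact h0 (h i j (not_le.1 h1))
  rw [key]
  constructor
  · intro h b i hi
    exact acyc_of_gradedTor_eq_bot hJ hU (h i _ hi)
  · intro h i j hij
    refine gradedTor_eq_bot hJ hU fun b hb => h b i ?_
    rwa [hb]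

end Compare

end SimplicialKoszul

/-! ### Even-connections -/

namespace EdgePower

variable {V : Type*} [DecidableEq V]

/-- The degree vector of an edge. -/
noncomputable def edgeDeg : Sym2 V → V →₀ ℕ :=
  Sym2.lift ⟨fun a b => Finsupp.single a 1 + Finsupp.single b 1, fun _ _ => add_comm _ _⟩

/-- The degree vector of a multiset of edges. -/
noncomputable def degs (A : Multiset (Sym2 V)) : V →₀ ℕ := (A.map edgeDeg).sum

@[simp] theorem degs_zero : degs (0 : Multiset (Sym2 V)) = 0 := rfl

theorem degs_add (A B : Multiset (Sym2 V)) : degs (A + B) = degs A + degs B := by simp [degs]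

theorem degs_cons (a b : V) (A : Multiset (Sym2 V)) :
    degs (s(a, b) ::ₘ A) = Finsupp.single a 1 + Finsupp.single b 1 + degs A := by
  simp [degs, edgeDeg]

theorem degs_cons_apply (a b : V) (A : Multiset (Sym2 V)) (x : V) :
    degs (s(a, b) ::ₘ A) x = (if a = x then 1 else 0) + (if b = x then 1 else 0) + degs A x := by
  simp [degs_cons, Finsupp.single_apply]

theorem degree_degs (A : Multiset (Sym2 V)) : (degs A).degree = 2 * Multiset.card A := by
  induction A using Multiset.induction_on with
  | empty => simp
  | cons e A ih =>
    induction e using Sym2.ind with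
    | h a b => rw [degs_cons, map_add, map_add, ih, Multiset.card_cons]; simp; ring

theorem exists_edge_of_degs_pos {A : Multiset (Sym2 V)} {u : V} (h : 0 < degs A u) :
    ∃ w A₁, A = s(u, w) ::ₘ A₁ := by
  induction A using Multiset.induction_on with
  | empty => simp at h
  | cons e A ih =>
    induction e using Sym2.ind with
    | h a b =>
      by_cases ha : a = u
      · exact ⟨b, A, by rw [ha]⟩
      by_cases hb : b = u
      · exact ⟨a, A, by rw [hb, Sym2.eq_swap]⟩
      rw [degs_cons_apply, if_neg ha, if_neg hb] at h
      obtain ⟨w, A₁, rfl⟩ := ih (by omega)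
      exact ⟨w, s(a, b) ::ₘ A₁, Multiset.cons_swap _ _ _⟩

/-- All members of the multiset are edges of `G`. -/
def IsEdges (G : SimpleGraph V) (A : Multiset (Sym2 V)) : Prop := ∀ e ∈ A, e ∈ G.edgeSet

theorem isEdges_cons {G : SimpleGraph V} {a b : V} {A : Multiset (Sym2 V)} :
    IsEdges G (s(a, b) ::ₘ A) ↔ G.Adj a b ∧ IsEdges G A := by
  simp [IsEdges]

theorem IsEdges.mono {G : SimpleGraph V} {A B : Multiset (Sym2 V)} (h : IsEdges G B) (hAB : A ≤ B) :
    IsEdges G A := fun e he => h e (Multiset.mem_of_le hAB he)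

theorem IsEdges.add {G : SimpleGraph V} {A B : Multiset (Sym2 V)} (hA : IsEdges G A)
    (hB : IsEdges G B) : IsEdges G (A + B) :=
  fun e he => (Multiset.mem_add.1 he).elim (hA e) (hB e)

/-- `Conn G C u v`: there is a walk of odd length from `u` to `v`, whose edges at odd places are
edges of `G` and whose edges at even places are the members of `C`. -/
inductive Conn (G : SimpleGraph V) : Multiset (Sym2 V) → V → V → Prop
  | single {u v : V} : G.Adj u v → Conn G 0 u v
  | step {u p q v : V} {C : Multiset (Sym2 V)} :
    G.Adj u p → Conn G C q v → Conn G (s(p, q) ::ₘ C) u v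

/-- `u` and `v` are adjacent, or even-connected with respect to the edges in `A`. -/
def EvenConn (G : SimpleGraph V) (A : Multiset (Sym2 V)) (u v : V) : Prop :=
  ∃ C ≤ A, Conn G C u v

variable {G : SimpleGraph V}

namespace Conn

theorem concat {C D : Multiset (Sym2 V)} {u p q v : V} (h : Conn G C u p) (h' : Conn G D q v) :
    Conn G (C + s(p, q) ::ₘ D) u v := by
  induction h with
  | single h => rw [zero_add]; exact step h h'
  | step h _ ih => rw [Multiset.cons_add]; exact step h ih

theorem symm {C : Multiset (Sym2 V)} {u v : V} (h : Conn G C u v) : Conn G C v u := by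
  induction h with
  | single h => exact single h.symm
  | @step u p q v C h _ ih =>
    have := ih.concat (single h.symm)
    rwa [Sym2.eq_swap, ← Multiset.singleton_add, add_zero, add_comm, Multiset.singleton_add] at this

theorem split {C : Multiset (Sym2 V)} {u v c d : V} (h : Conn G C u v) (hm : s(c, d) ∈ C) :
    ∃ C₁ C₂, C = C₁ + s(c, d) ::ₘ C₂ ∧
      (Conn G C₁ u c ∧ Conn G C₂ d v ∨ Conn G C₁ u d ∧ Conn G C₂ c v) := by
  induction h with
  | single h => simp at hm
  | @step u p q v C h hC ih =>
    rcases Multiset.mem_cons.1 hm with hm | hm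
    · refine ⟨0, C, by rw [hm, zero_add], ?_⟩
      rw [Sym2.eq_iff] at hm
      rcases hm with ⟨rfl, rfl⟩ | ⟨rfl, rfl⟩
      · exact Or.inl ⟨single h, hC⟩
      · exact Or.inr ⟨single h, hC⟩
    · obtain ⟨C₁, C₂, rfl, h1⟩ := ih hm
      exact ⟨s(p, q) ::ₘ C₁, C₂, by rw [Multiset.cons_add],
        h1.imp (fun h1 => ⟨step h h1.1, h1.2⟩) (fun h1 => ⟨step h h1.1, h1.2⟩)⟩

/-- Either a walk does not use an edge of `D`, or it has an initial part up to one. -/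
theorem first {C : Multiset (Sym2 V)} {u v : V} (h : Conn G C u v) (D : Multiset (Sym2 V)) :
    Disjoint C D ∨ ∃ c d C₀, C₀ ≤ C ∧ Disjoint C₀ D ∧ s(c, d) ∈ D ∧ Conn G C₀ u c := by
  induction h with
  | single h => exact Or.inl (by simp)
  | @step u p q v C h hC ih =>
    by_cases hm : s(p, q) ∈ D
    · exact Or.inr ⟨p, q, 0, by simp, by simp, hm, single h⟩
    · rcases ih with ih | ⟨c, d, C₀, h1, h2, h3, h4⟩
      · exact Or.inl (Multiset.disjoint_cons_left.2 ⟨hm, ih⟩)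
      · exact Or.inr ⟨c, d, s(p, q) ::ₘ C₀, (Multiset.cons_le_cons_iff _).2 h1,
          Multiset.disjoint_cons_left.2 ⟨hm, h2⟩, h3, step h h4⟩

/-- The edges at odd places cover the two ends and every inner vertex, while those at even places
miss the ends. -/
theorem exists_edges {C : Multiset (Sym2 V)} {u v : V} (h : Conn G C u v) :
    ∃ B, IsEdges G B ∧ Multiset.card B = Multiset.card C + 1 ∧
      degs B = Finsupp.single u 1 + Finsupp.single v 1 + degs C := by
  induction h with
  | @single u v h =>
    refine ⟨{s(u, v)}, by simpa [IsEdges] using h, by simp, ?_⟩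
    rw [← Multiset.cons_zero, degs_cons]
  | @step u p q v C h _ ih =>
    obtain ⟨B, h1, h2, h3⟩ := ih
    refine ⟨s(u, p) ::ₘ B, isEdges_cons.2 ⟨h, h1⟩, by simp [h2], ?_⟩
    rw [degs_cons, degs_cons, h3]
    abel

end Conn

/-- This allows two walks without a common even edge to be joined without exceeding the
multiplicities in `A`. -/
theorem add_le_of_disjoint {A C D : Multiset (Sym2 V)} (hC : C ≤ A) (hD : D ≤ A)
    (h : Disjoint C D) : C + D ≤ A := by
  rw [Multiset.add_eq_union_iff_disjoint.2 h]
  exact Multiset.union_le hC hD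

namespace EvenConn

variable {A : Multiset (Sym2 V)} {u v : V}

theorem symm (h : EvenConn G A u v) : EvenConn G A v u :=
  let ⟨C, hC, h⟩ := h; ⟨C, hC, h.symm⟩

theorem of_adj (h : G.Adj u v) : EvenConn G A u v := ⟨0, Multiset.zero_le _, .single h⟩

theorem mono {B : Multiset (Sym2 V)} (h : EvenConn G A u v) (hAB : A ≤ B) : EvenConn G B u v :=
  let ⟨C, hC, h⟩ := h; ⟨C, hC.trans hAB, h⟩

/-- A vertex that is connected to an inner vertex of a walk is connected to one of its ends. -/
theorem left_or_right {x t t' : V} {C : Multiset (Sym2 V)} (h : EvenConn G A x t) (hC : C ≤ A)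
    (hconn : Conn G C u v) (ht : s(t, t') ∈ C) : EvenConn G A x u ∨ EvenConn G A x v := by
  obtain ⟨D, hD, hxt⟩ := h
  -- The walk from `x` is cut at the first even edge shared with `C`; if there is none, it is kept
  -- whole and enters `C` through `tt'`.
  obtain ⟨c, d, D₀, h1, h2, h3, h4⟩ :
      ∃ c d D₀, D₀ ≤ D ∧ Disjoint D₀ C ∧ s(c, d) ∈ C ∧ Conn G D₀ x c := by
    rcases hxt.first C with h | h
    · exact ⟨t, t', D, le_rfl, h, ht, hxt⟩
    · exact h
  obtain ⟨C₁, C₂, rfl, h5 | h5⟩ := hconn.split h3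
  · right
    refine ⟨_, ?_, h4.concat h5.2⟩
    exact add_le_of_disjoint (h1.trans hD) ((Multiset.le_add_left _ _).trans hC)
      (Multiset.disjoint_add_right.1 h2).2
  · left
    refine ⟨_, ?_, h4.concat h5.1.symm⟩
    have h6 : s(c, d) ::ₘ C₁ ≤ C₁ + s(c, d) ::ₘ C₂ := by
      rw [Multiset.add_cons, ← Multiset.cons_add]; exact Multiset.le_add_right _ _
    exact add_le_of_disjoint (h1.trans hD) (h6.trans hC)
      (h2.mono_right h6)

end EvenConn

/-- The exchange property of degree vectors of multisets of edges. -/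
theorem exchange {A B : Multiset (Sym2 V)} (hA : IsEdges G A) (hB : IsEdges G B) {u : V}
    (h : degs A u < degs B u) :
    (∃ v, EvenConn G A u v ∧ (degs A + Finsupp.single u 1 : V →₀ ℕ) v < degs B v) ∨
    ∃ v, v ≠ u ∧ degs B v < degs A v ∧ ∃ A' B', IsEdges G A' ∧ IsEdges G B' ∧
      Multiset.card A' = Multiset.card A ∧ Multiset.card B' = Multiset.card B ∧
      degs A' + Finsupp.single v 1 = degs A + Finsupp.single u 1 ∧
      degs B' + Finsupp.single u 1 = degs B + Finsupp.single v 1 := by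
  induction hn : Multiset.card B generalizing A B u with
  | zero => rw [Multiset.card_eq_zero] at hn; simp [hn] at h
  | succ n ih =>
    -- An alternating trail is followed: an edge `uw` of `B`, then an edge `wz` of `A`. It stops at
    -- a surplus of `B` in `w`, or at a surplus of `A` in `z`, where the two edges are swapped.
    obtain ⟨w, B₁, rfl⟩ := exists_edge_of_degs_pos (Nat.zero_lt_of_lt h)
    obtain ⟨huw, hB₁⟩ := isEdges_cons.1 hB
    have hne := huw.ne
    by_cases hw : degs A w < degs (s(u, w) ::ₘ B₁) w
    · exact Or.inl ⟨w, .of_adj huw, by simpa [hne] using hw⟩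
    obtain ⟨z, A₁, rfl⟩ := exists_edge_of_degs_pos (A := A) (u := w) (by
      rw [degs_cons_apply] at hw; simp at hw; omega)
    obtain ⟨hwz, hA₁⟩ := isEdges_cons.1 hA
    have hne' := hwz.ne
    rw [Multiset.card_cons] at hn
    by_cases hz : z ≠ u ∧ degs (s(u, w) ::ₘ B₁) z < degs (s(w, z) ::ₘ A₁) z
    · refine Or.inr ⟨z, hz.1, hz.2, s(u, w) ::ₘ A₁, s(w, z) ::ₘ B₁, isEdges_cons.2 ⟨huw, hA₁⟩,
        isEdges_cons.2 ⟨hwz, hB₁⟩, by simp, by simp [hn], ?_, ?_⟩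
      · rw [degs_cons, degs_cons]; abel
      · rw [degs_cons, degs_cons]; abel
    -- With both edges discarded, `B` is in surplus at `z`, so the trail continues from there.
    have hz' : degs A₁ z < degs B₁ z := by
      by_cases hzu : z = u
      · subst hzu
        simp only [degs_cons_apply, if_true, hne', if_false] at h
        omega
      · have hz2 := not_and.1 hz hzu
        simp only [degs_cons_apply, if_true, hne', Ne.symm hzu, if_false] at hz2
        omega
    rcases ih hA₁ hB₁ hz' (by omega) with ⟨v, ⟨C, hC, hv⟩, hlt⟩ | ⟨v, hvz, hlt, A', B', h1⟩
    · refine Or.inl ⟨v, ⟨_, (Multiset.cons_le_cons_iff _).2 hC, .step huw hv⟩, ?_⟩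
      simp only [Finsupp.add_apply, degs_cons_apply, Finsupp.single_apply] at hlt ⊢
      split_ifs at hlt ⊢ <;> omega
    · obtain ⟨hA', hB', hcA, hcB, hdA, hdB⟩ := h1
      refine Or.inr ⟨v, ?_, ?_, s(u, w) ::ₘ A', s(w, z) ::ₘ B', isEdges_cons.2 ⟨huw, hA'⟩,
        isEdges_cons.2 ⟨hwz, hB'⟩, by simp [hcA], by simp [hcB], ?_, ?_⟩
      · rintro rfl
        simp only [degs_cons_apply, if_true, hne.symm, Ne.symm hvz, if_false] at h
        omega
      · simp only [degs_cons_apply]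
        have : v ≠ u := by
          rintro rfl
          simp only [degs_cons_apply, if_true, hne.symm, Ne.symm hvz, if_false] at h
          omega
        simp only [Ne.symm this, Ne.symm hvz, if_false]
        omega
      · rw [degs_cons, degs_cons, add_assoc, hdA]; abel
      · rw [degs_cons, degs_cons]
        have := congrArg (fun m => m + Finsupp.single u 1 + Finsupp.single w 1) hdB
        calc _ = degs B' + Finsupp.single z 1 + Finsupp.single u 1 + Finsupp.single w 1 := by abel
          _ = _ := by rw [this]; abel

/-- The exponents of the monomials in the `s`-th power of the edge ideal. -/
def powerSet (G : SimpleGraph V) (s : ℕ) : Set (V →₀ ℕ) :=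
  {m | ∃ B, IsEdges G B ∧ Multiset.card B = s ∧ degs B ≤ m}

theorem isUpperSet_powerSet (G : SimpleGraph V) (s : ℕ) : IsUpperSet (powerSet G s) := by
  rintro m m' h ⟨B, h1, h2, h3⟩
  exact ⟨B, h1, h2, h3.trans h⟩

theorem powerSet_succ_subset (G : SimpleGraph V) (s : ℕ) : powerSet G (s + 1) ⊆ powerSet G s := by
  rintro m ⟨B, h1, h2, h3⟩
  obtain ⟨e, he⟩ := Multiset.card_pos_iff_exists_mem.1 (by omega : 0 < Multiset.card B)
  obtain ⟨B', rfl⟩ := Multiset.exists_cons_of_mem he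
  refine ⟨B', h1.mono (Multiset.le_cons_self _ _), by simpa using h2, le_trans ?_ h3⟩
  rw [← Multiset.singleton_add, degs_add]
  exact le_add_self

/-- The exponents of the ideal generated by the products `x_u x_v`, for `u, v ∈ Y` related
by `H`. -/
def quadric (H : V → V → Prop) (Y : Finset V) : Set (V →₀ ℕ) :=
  {m | ∃ u ∈ Y, ∃ v ∈ Y, H u v ∧ Finsupp.single u 1 + Finsupp.single v 1 ≤ m}

theorem isUpperSet_quadric (H : V → V → Prop) (Y : Finset V) : IsUpperSet (quadric H Y) := by
  rintro m m' h ⟨u, hu, v, hv, h1, h2⟩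
  exact ⟨u, hu, v, hv, h1, h2.trans h⟩

theorem add_degs_mem_powerSet {A : Multiset (Sym2 V)} (hA : IsEdges G A) {n : V →₀ ℕ} {u v : V}
    (h : EvenConn G A u v) (hn : Finsupp.single u 1 + Finsupp.single v 1 ≤ n) :
    n + degs A ∈ powerSet G (Multiset.card A + 1) := by
  obtain ⟨C, hC, h⟩ := h
  obtain ⟨B, h1, h2, h3⟩ := h.exists_edges
  obtain ⟨D, rfl⟩ := Multiset.le_iff_exists_add.1 hC
  refine ⟨B + D, h1.add (hA.mono (Multiset.le_add_left _ _)), ?_, ?_⟩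
  · rw [Multiset.card_add, Multiset.card_add, h2]; ring
  · rw [degs_add, degs_add, h3, add_assoc]
    gcongr

/-- The extra `single u 1` in `hv` provides the second factor when `u = v`. -/
theorem single_add_single_le {A B : Multiset (Sym2 V)} {n : V →₀ ℕ} {u v : V}
    (hle : degs B ≤ n + degs A) (hu : degs A u < degs B u)
    (hv : (degs A + Finsupp.single u 1 : V →₀ ℕ) v < degs B v) :
    Finsupp.single u 1 + Finsupp.single v 1 ≤ n := by
  intro x
  have h1 := hle x
  simp only [Finsupp.add_apply, Finsupp.single_apply] at *
  by_cases hux : u = x <;> by_cases hvx : v = x <;> (try subst hux) <;> (try subst hvx) <;>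
    simp_all <;> omega

/-- As `B` has one edge more than `A`, it has a surplus somewhere. Exchange there gives a connected
pair dividing `n`, or replaces `B` by a multiset with smaller deficit `degs A - degs B` that still
divides. -/
theorem exists_evenConn_of_mem_powerSet {A : Multiset (Sym2 V)} (hA : IsEdges G A) {n : V →₀ ℕ}
    (h : n + degs A ∈ powerSet G (Multiset.card A + 1)) :
    ∃ u v, EvenConn G A u v ∧ Finsupp.single u 1 + Finsupp.single v 1 ≤ n := by
  obtain ⟨B, hB, hc, hle⟩ := h
  induction hd : (degs A - degs B).degree using Nat.strong_induction_on generalizing B with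
  | _ d ih =>
    obtain ⟨u, hu⟩ : ∃ u, degs A u < degs B u := by
      by_contra! h
      have : (degs B).degree ≤ (degs A).degree := Finsupp.degree_mono (show degs B ≤ degs A from h)
      rw [degree_degs, degree_degs] at this
      omega
    rcases exchange hA hB hu with ⟨v, h1, h2⟩ | ⟨v, hvu, hv, A', B', -, hB', -, hcB, -, hdB⟩
    · exact ⟨u, v, h1, single_add_single_le hle hu h2⟩
    · have hx : ∀ x, degs B' x + (if u = x then 1 else 0) =
          degs B x + (if v = x then 1 else 0) := fun x => by
        have := DFunLike.congr_fun hdB x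
        simpa [Finsupp.single_apply] using this
      refine ih _ ?_ B' hB' (by omega) (fun x => ?_) rfl
      · have hle' : (degs A - degs B') + Finsupp.single v 1 ≤ degs A - degs B := by
          intro x
          have := hx x
          simp only [Finsupp.add_apply, Finsupp.tsub_apply, Finsupp.single_apply]
          by_cases h1 : u = x
          · subst h1; simp only [hvu, if_true, if_false] at this ⊢; omega
          · by_cases h2 : v = x
            · subst h2; simp only [h1, if_true, if_false] at this ⊢; omega
            · simp only [h1, h2, if_false] at this ⊢; omega
        have := Finsupp.degree_mono hle'
        rw [map_add] at this
        simp at this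
        omega
      · have := hx x
        have h1 := hle x
        simp only [Finsupp.add_apply] at h1 ⊢
        by_cases h2 : v = x
        · subst h2; simp only [hvu.symm, if_true, if_false] at this; omega
        · simp only [h2, if_false] at this; omega

theorem colon_powerSet {A : Multiset (Sym2 V)} [Fintype V] (hA : IsEdges G A) :
    {n | n + degs A ∈ powerSet G (Multiset.card A + 1)} =
      quadric (EvenConn G A) Finset.univ := by
  ext n
  constructor
  · intro h
    obtain ⟨u, v, h1, h2⟩ := exists_evenConn_of_mem_powerSet hA h
    exact ⟨u, Finset.mem_univ _, v, Finset.mem_univ _, h1, h2⟩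
  · rintro ⟨u, -, v, -, h1, h2⟩
    exact add_degs_mem_powerSet hA h1 h2

end EdgePower

/-! ### Regularity of quadrics and of powers of edge ideals -/

namespace EdgePower

open Finset SimplicialKoszul

section Restrict

variable {V : Type*} [DecidableEq V] {G : SimpleGraph V}

/-- The graph on the same vertices whose edges are the edges of `G` between vertices in `W`. -/
def restrict (G : SimpleGraph V) (W : Set V) : SimpleGraph V where
  Adj u v := G.Adj u v ∧ u ∈ W ∧ v ∈ W
  symm := ⟨fun _ _ h => ⟨h.1.symm, h.2.2, h.2.1⟩⟩
  loopless := ⟨fun _ h => h.1.ne rfl⟩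

theorem Conn.restrict {C : Multiset (Sym2 V)} {u v : V} (h : Conn G C u v) {W : Set V} (hu : u ∈ W)
    (hv : v ∈ W) (hC : ∀ e ∈ C, ∀ x ∈ e, x ∈ W) : Conn (restrict G W) C u v := by
  induction h with
  | single h => exact .single ⟨h, hu, hv⟩
  | @step u p q v C h _ ih =>
    have hpq := hC s(p, q) (Multiset.mem_cons_self _ _)
    exact .step ⟨h, hu, hpq p (Sym2.mem_mk_left _ _)⟩
      (ih (hpq q (Sym2.mem_mk_right _ _)) hv fun e he => hC e (Multiset.mem_cons_of_mem he))

theorem Conn.of_restrict {C : Multiset (Sym2 V)} {u v : V} {W : Set V}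
    (h : Conn (EdgePower.restrict G W) C u v) : Conn G C u v := by
  induction h with
  | single h => exact .single h.1
  | step h _ ih => exact .step h.1 ih

open Classical in
/-- Away from the vertices connected to `x`, connections are those of the induced subgraph. -/
theorem evenConn_restrict_iff {A : Multiset (Sym2 V)} {x u v : V} {W : Set V}
    (hW : W = {y | y ≠ x ∧ ¬ EvenConn G A x y}) (hu : u ∈ W) (hv : v ∈ W) :
    EvenConn (restrict G W) (A.filter fun e => ∀ t ∈ e, t ∈ W) u v ↔ EvenConn G A u v := by
  constructor
  · rintro ⟨C, hC, h⟩
    exact ⟨C, hC.trans (Multiset.filter_le _ _), h.of_restrict⟩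
  · rintro ⟨C, hC, h⟩
    rw [hW] at hu hv
    -- If the walk passed through `x` or through a vertex connected to `x`, one of its ends would be
    -- connected to `x`.
    have key : ∀ e ∈ C, ∀ t ∈ e, t ∈ W := by
      intro e he t ht
      obtain ⟨t', rfl⟩ := Sym2.mem_iff_exists.1 ht
      rw [hW]
      refine ⟨?_, fun hx => ?_⟩
      · rintro rfl
        obtain ⟨C₁, C₂, rfl, h1 | h1⟩ := h.split he
        · exact hu.2 (EvenConn.symm ⟨C₁, (Multiset.le_add_right _ _).trans hC, h1.1⟩)
        · exact hv.2 ⟨C₂, ((Multiset.le_cons_self _ _).trans (Multiset.le_add_left _ _)).trans hC,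
            h1.2⟩
      · exact (hx.left_or_right hC h he).elim hu.2 hv.2
    rw [← hW] at hu hv
    exact ⟨C, Multiset.le_filter.2 ⟨hC, key⟩, h.restrict hu hv key⟩

theorem isEdges_filter_restrict {A : Multiset (Sym2 V)} (hA : IsEdges G A) (W : Set V)
    [DecidablePred fun e : Sym2 V => ∀ t ∈ e, t ∈ W] :
    IsEdges (restrict G W) (A.filter fun e => ∀ t ∈ e, t ∈ W) := by
  intro e he
  obtain ⟨h1, h2⟩ := Multiset.mem_filter.1 he
  have := hA e h1
  induction e using Sym2.ind with
  | h a b => exact ⟨this, h2 a (Sym2.mem_mk_left _ _), h2 b (Sym2.mem_mk_right _ _)⟩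

end Restrict

/-! ### Quadrics, and the passage from one power to the next. -/

variable {k : Type*} [Field k] {V : Type*} [LinearOrder V] [Fintype V] {G : SimpleGraph V}

theorem quadric_congr {H H' : V → V → Prop} {Y : Finset V}
    (h : ∀ u ∈ Y, ∀ v ∈ Y, (H u v ↔ H' u v)) : quadric H Y = quadric H' Y := by
  ext m
  constructor
  · rintro ⟨u, hu, v, hv, h1, h2⟩
    exact ⟨u, hu, v, hv, (h u hu v hv).1 h1, h2⟩
  · rintro ⟨u, hu, v, hv, h1, h2⟩
    exact ⟨u, hu, v, hv, (h u hu v hv).2 h1, h2⟩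

theorem quadric_eq_empty {H : V → V → Prop} {Y : Finset V} (h : ∀ u ∈ Y, ∀ v ∈ Y, ¬ H u v) :
    quadric H Y = ∅ := by
  ext m
  simp only [Set.mem_empty_iff_false, iff_false]
  rintro ⟨u, hu, v, hv, h1, -⟩
  exact h u hu v hv h1

theorem single_add_single_le_iff {u v : V} {m : V →₀ ℕ} :
    Finsupp.single u 1 + Finsupp.single v 1 ≤ m ↔
      ∀ x, (if u = x then 1 else 0) + (if v = x then 1 else 0) ≤ m x := by
  refine forall_congr' fun x => ?_
  simp [Finsupp.single_apply]

open Classical in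
/-- Bounding the regularity of a quadric by removing a vertex. -/
theorem regLE_quadric_of_erase {H : V → V → Prop} (hH : ∀ u v, H u v → H v u) {Y : Finset V}
    {x : V} (hx : x ∈ Y) {r : ℤ} (hr : 2 ≤ r)
    (h₁ : RegLE k (quadric H ((Y.erase x).filter fun y => ¬ H x y)) (r - 1))
    (h₂ : RegLE k (quadric H (Y.erase x)) r) : RegLE k (quadric H Y) r := by
  refine RegLE.of_colon_of_erase (isUpperSet_quadric H Y) x ?_ ?_
  -- The colon by `x` contains the variable of each neighbour of `x`, including `x` itself when `H x
  -- x`; beyond these, only pairs of non-neighbours remain. Adding variables needs `1 ≤ r - 1`.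
  · convert RegLE.union_variables (isUpperSet_quadric _ _) (by linarith) h₁
      (Y.filter fun y => H x y) using 1
    ext m
    simp only [quadric, Set.mem_ofPred_eq, Set.mem_union, mem_filter, mem_erase,
      single_add_single_le_iff, Finsupp.add_apply, Finsupp.single_apply]
    constructor
    · rintro ⟨u, hu, v, hv, huv, hle⟩
      by_cases h : ∃ y, (y ∈ Y ∧ H x y) ∧ m y ≠ 0
      · exact Or.inr h
      · left
        push Not at h
        have hux : u ≠ x := by
          intro hux
          have h1 := h v ⟨hv, hux ▸ huv⟩
          have := hle v
          by_cases hc : x = v <;> simp [h1, hc, hux] at this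
        have hvx : v ≠ x := by
          intro hvx
          have h1 := h u ⟨hu, hvx ▸ hH _ _ huv⟩
          have := hle u
          by_cases hc : x = u <;> simp [h1, hc, hvx] at this
        have key : ∀ y, (if u = y then 1 else 0) + (if v = y then 1 else 0) ≤ m y := by
          intro y
          have := hle y
          by_cases hy : x = y
          · subst hy; simp [hux, hvx]
          · simpa [hy] using this
        refine ⟨u, ⟨⟨hux, hu⟩, fun h1 => ?_⟩, v, ⟨⟨hvx, hv⟩, fun h1 => ?_⟩, huv, key⟩
        · have h2 := h u ⟨hu, h1⟩
          have := key u
          simp at this; omega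
        · have h2 := h v ⟨hv, h1⟩
          have := key v
          simp at this; omega
    · rintro (⟨u, ⟨⟨-, hu⟩, -⟩, v, ⟨⟨-, hv⟩, -⟩, huv, hle⟩ | ⟨y, ⟨hy, hxy⟩, hmy⟩)
      · exact ⟨u, hu, v, hv, huv, fun y => (hle y).trans (Nat.le_add_right _ _)⟩
      · refine ⟨x, hx, y, hy, hxy, fun t => ?_⟩
        by_cases h1 : y = t
        · subst h1; split_ifs <;> omega
        · simp [h1]
  · convert h₂ using 1
    ext m
    simp only [quadric, Set.mem_ofPred_eq, mem_erase, single_add_single_le_iff]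
    constructor
    · rintro ⟨u, hu, v, hv, huv, hle⟩
      have hux : u ≠ x := by
        rintro rfl
        have := hle u
        simp at this
      have hvx : v ≠ x := by
        rintro rfl
        have := hle v
        simp at this
      refine ⟨u, ⟨hux, hu⟩, v, ⟨hvx, hv⟩, huv, fun y => (hle y).trans ?_⟩
      rw [Finsupp.erase_apply]; split_ifs <;> simp
    · rintro ⟨u, ⟨hux, hu⟩, v, ⟨hvx, hv⟩, huv, hle⟩
      refine ⟨u, hu, v, hv, huv, fun y => ?_⟩
      rw [Finsupp.erase_apply]
      split_ifs with h1 h2 h3 <;> simp_all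
      all_goals first | omega | (have := hle y; simp_all)

theorem quadric_union_variables {H : V → V → Prop} (T : Finset V) :
    quadric H univ ∪ {m | ∃ x ∈ T, m x ≠ 0} = quadric H Tᶜ ∪ {m | ∃ x ∈ T, m x ≠ 0} := by
  ext m
  simp only [Set.mem_union, quadric, Set.mem_ofPred_eq, mem_univ, true_and, mem_compl]
  constructor
  · rintro (⟨u, v, huv, hle⟩ | h)
    · by_cases h : ∃ x ∈ T, m x ≠ 0
      · exact Or.inr h
      · push Not at h
        refine Or.inl ⟨u, fun hu => ?_, v, fun hv => ?_, huv, hle⟩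
        · have := hle u
          simp [h u hu] at this
        · have := hle v
          simp [h v hv] at this
    · exact Or.inr h
  · rintro (⟨u, -, v, -, huv, hle⟩ | h)
    · exact Or.inl ⟨u, v, huv, hle⟩
    · exact Or.inr h

/-- Since `m` and `m'` agree before `u`, the vertex `v` comes after `u`; trading `v` for `u` then
increases the exponent lexicographically. -/
theorem lex_lt_of_exchange {m m' m'' : V →₀ ℕ} {u v : V} (hlt : ∀ x < u, m x = m' x)
    (hv : m' v < m v) (hvu : v ≠ u)
    (h : m'' + Finsupp.single v 1 = m + Finsupp.single u 1) : toLex m < toLex m'' := by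
  have hx : ∀ x, m'' x + (if v = x then 1 else 0) = m x + (if u = x then 1 else 0) := fun x => by
    simpa [Finsupp.single_apply] using DFunLike.congr_fun h x
  have huv : u < v := by
    refine lt_of_le_of_ne (not_lt.1 fun h1 => ?_) hvu.symm
    have := hlt v h1
    omega
  rw [Finsupp.Lex.lt_iff]
  refine ⟨u, fun x hxu => ?_, ?_⟩
  · have := hx x
    rw [if_neg (hxu.trans huv).ne', if_neg hxu.ne'] at this
    simpa using this.symm
  · have := hx u
    rw [if_neg hvu, if_pos rfl] at this
    change m u < m'' u
    omega

/-- The regularity of a power of an edge ideal, in terms of the regularity of the previous power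
and of the quadrics of even-connected pairs. -/
theorem regLE_powerSet_succ {s : ℕ} {r : ℤ} (hr : 1 ≤ r - 2 * s)
    (h₀ : RegLE k (powerSet G s) r)
    (h₁ : ∀ A, IsEdges G A → Multiset.card A = s → ∀ Y : Finset V,
      RegLE k (quadric (EvenConn G A) Y) (r - 2 * s)) :
    RegLE k (powerSet G (s + 1)) r := by
  classical
  let IsGen : Lex (V →₀ ℕ) → Prop := fun m =>
    ∃ A, IsEdges G A ∧ Multiset.card A = s ∧ degs A = ofLex m
  let U : Finset (Lex (V →₀ ℕ)) → Set (V →₀ ℕ) := fun L =>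
    powerSet G (s + 1) ∪ {n | ∃ m ∈ L, ofLex m ≤ n}
  have hU : ∀ L, IsUpperSet (U L) := fun L => by
    refine (isUpperSet_powerSet G _).union ?_
    rintro n n' h ⟨m, hm, hle⟩
    exact ⟨m, hm, hle.trans h⟩
  -- `L` is an upper segment of the generators of the `s`-th power, and its least element is removed
  -- at each step. The full segment gives the `s`-th power, the empty one the next power.
  have key : ∀ L : Finset (Lex (V →₀ ℕ)), (∀ m ∈ L, IsGen m) →
      (∀ m ∈ L, ∀ m', IsGen m' → m < m' → m' ∈ L) → RegLE k (U L) r →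
      RegLE k (powerSet G (s + 1)) r := by
    intro L
    induction L using Finset.induction_on_min with
    | empty => intro _ _ h; simpa [U] using h
    | insert a L haL ih =>
      intro hgen hup hreg
      have hup' : ∀ m', IsGen m' → a < m' → m' ∈ L := fun m' hm' h =>
        mem_of_mem_insert_of_ne (hup a (mem_insert_self _ _) m' hm' h) h.ne'
      refine ih (fun m hm => hgen m (mem_insert_of_mem hm))
        (fun m hm m' hm' h => hup' m' hm' ((haL m hm).trans h)) ?_
      refine RegLE.of_union_Ici (hU L) (ofLex a) ?_ ?_
      · convert hreg using 1
        ext n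
        simp only [U, Set.mem_union, Set.mem_ofPred_eq, Set.mem_Ici, mem_insert, exists_eq_or_imp]
        rw [or_assoc, or_comm (b := ofLex a ≤ n)]
      · obtain ⟨A, hA, hAs, hAa⟩ := hgen a (mem_insert_self _ _)
        have hdeg : ((ofLex a).degree : ℤ) = 2 * s := by
          rw [← hAa, degree_degs, hAs]; push_cast; ring
        rw [hdeg]
        -- These are the variables that a larger generator contributes to the colon by `a`.
        let T : Finset V := univ.filter fun u => ∃ m ∈ L, ofLex m ≤ ofLex a + Finsupp.single u 1
        have hcolon : {n | n + ofLex a ∈ U L} =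
            quadric (EvenConn G A) univ ∪ {m | ∃ x ∈ T, m x ≠ 0} := by
          ext n
          simp only [U, Set.mem_ofPred_eq, Set.mem_union, T, mem_filter, mem_univ, true_and]
          constructor
          · rintro (h | ⟨m, hm, hle⟩)
            · left
              rw [← colon_powerSet hA, hAs, hAa]
              exact h
            · have hlt : a < m := haL m hm
              rw [Finsupp.Lex.lt_iff] at hlt
              obtain ⟨u, hu1, hu2⟩ := hlt
              obtain ⟨B, hB, hBs, hBm⟩ := hgen m (mem_insert_of_mem hm)
              have hu3 : degs A u < degs B u := by rw [hAa, hBm]; exact hu2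
              rw [← hBm, ← hAa] at hle
              rcases exchange hA hB hu3 with ⟨v, h1, h2⟩ |
                ⟨v, hvu, hv, A', B', hA', -, hcA, -, hdA, -⟩
              · exact Or.inl ⟨u, mem_univ _, v, mem_univ _, h1, single_add_single_le hle hu3 h2⟩
              -- The exchanged generator is larger than `a`, hence still present, and it divides `a`
              -- times `x_u`.
              · refine Or.inr ⟨u, ⟨toLex (degs A'), hup' _ ⟨A', hA', by omega, rfl⟩ ?_, ?_⟩, ?_⟩
                · refine lex_lt_of_exchange (m := degs A) (m' := degs B) (u := u) (v := v) ?_ hv hvu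
                    hdA |>.trans_eq' ?_
                  · intro x hx
                    rw [hAa, hBm]; exact hu1 x hx
                  · rw [hAa]; rfl
                · rw [← hAa, ← hdA]
                  exact le_self_add
                · have := hle u
                  rw [Finsupp.add_apply] at this
                  omega
          · rintro (h | ⟨u, ⟨m, hm, hle⟩, hn⟩)
            · left
              rw [← colon_powerSet hA, hAs, hAa] at h
              exact h
            · refine Or.inr ⟨m, hm, hle.trans ?_⟩
              rw [add_comm]
              gcongr
              simpa using Nat.one_le_iff_ne_zero.2 hn
        -- Modulo the variables in `T` only pairs outside `T` count, which is why `h₁` ranges over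
        -- all vertex subsets.
        rw [hcolon, quadric_union_variables]
        exact RegLE.union_variables (isUpperSet_quadric _ _) hr (h₁ A hA hAs _) _
  let E : Finset (Lex (V →₀ ℕ)) :=
    (((univ : Finset V).finsuppAntidiag (2 * s)).map toLex.toEmbedding).filter IsGen
  have hE : ∀ m, m ∈ E ↔ IsGen m := fun m => by
    simp only [E, mem_filter, mem_map_equiv, and_iff_right_iff_imp]
    rintro ⟨A, -, hAs, hAm⟩
    rw [mem_finsuppAntidiag]
    refine ⟨?_, by simp⟩
    rw [← Finsupp.degree_eq_sum, show toLex.symm m = degs A from hAm.symm, degree_degs, hAs]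
  refine key E (fun m hm => (hE m).1 hm) (fun m _ m' hm' _ => (hE m').2 hm') ?_
  convert h₀ using 1
  ext n
  simp only [U, Set.mem_union, Set.mem_ofPred_eq, hE]
  constructor
  · rintro (h | ⟨m, ⟨A, hA, hAs, hAm⟩, hle⟩)
    · exact powerSet_succ_subset G s h
    · exact ⟨A, hA, hAs, hAm ▸ hle⟩
  · rintro ⟨A, hA, hAs, hle⟩
    exact Or.inr ⟨toLex (degs A), ⟨A, hA, hAs, rfl⟩, hle⟩

end EdgePower

/-! ### Anticycles -/

namespace EdgePower

section Anticycle

variable {V : Type*}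

/-- The vertices `w 0, …, w (n - 1)` form an induced cycle, without loops, of length `n ≥ 4` in the
complement of the symmetric relation `H`. -/
def IsAnticycle (H : V → V → Prop) (n : ℕ) (w : ℕ → V) : Prop :=
  4 ≤ n ∧ ∀ i j, i ≤ j → j < n → (H (w i) (w j) ↔ i + 2 ≤ j ∧ ¬ (i = 0 ∧ j + 1 = n))

/-- Among two edges without common vertex there are adjacent ones. -/
def GapFree (G : SimpleGraph V) : Prop :=
  ∀ ⦃a b c d⦄, G.Adj a b → G.Adj c d → G.Adj a c ∨ G.Adj a d ∨ G.Adj b c ∨ G.Adj b d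

/-- The complement of a 4-cycle is a pair of disjoint edges with no edge between them. -/
theorem gapFree_of_forall_not_isAnticycle {G : SimpleGraph V}
    (h : ∀ n w, ¬ IsAnticycle G.Adj n w) : GapFree G := by
  intro a b c d hab hcd
  by_contra! hno
  obtain ⟨hac, had, hbc, hbd⟩ := hno
  refine h 4 (fun i => match i with | 0 => a | 1 => c | 2 => b | _ => d) ⟨le_rfl, ?_⟩
  intro i j hij hj
  have hca := fun h : G.Adj c a => hac h.symm
  have hcb := fun h : G.Adj c b => hbc h.symm
  interval_cases j <;> interval_cases i <;> simp_all

/-- Equal vertices could only be cyclically consecutive, as there are no loops; a further cyclic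
neighbour of one of them tells them apart because `n ≥ 4`. -/
theorem IsAnticycle.ne {H : V → V → Prop} {n : ℕ} {w : ℕ → V} (h : IsAnticycle H n w)
    (hH : ∀ u v, H u v → H v u) {i j : ℕ} (hij : i < j) (hj : j < n) : w i ≠ w j := by
  intro he
  obtain ⟨hn, h⟩ := h
  have hii := h i i le_rfl (by omega)
  have h0 := h i j hij.le hj
  rw [← he] at h0
  by_cases hc : i + 2 ≤ j ∧ ¬ (i = 0 ∧ j + 1 = n)
  · have := hii.1 (h0.2 hc)
    omega
  by_cases hi : i = 0
  · subst hi
    by_cases hj1 : j = 1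
    · have h1 := (h 0 2 (by omega) (by omega))
      have h2 := (h 1 2 (by omega) (by omega))
      rw [← hj1, ← he] at h2
      have := h2.1 (h1.2 (by omega))
      omega
    · have h1 := (h 0 1 (by omega) (by omega))
      have h2 := (h 1 j (by omega) (by omega))
      rw [← he] at h2
      have := h1.1 (hH _ _ (h2.2 (by omega)))
      omega
  · have hj1 : j = i + 1 := by omega
    by_cases hjn : j + 1 = n
    · have h1 := h (i - 1) i (by omega) (by omega)
      have h2 := h (i - 1) j (by omega) (by omega)
      rw [← he] at h2
      have := h1.1 (h2.2 (by omega))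
      omega
    · have h1 := h i (j + 1) (by omega) (by omega)
      have h2 := h j (j + 1) (by omega) (by omega)
      rw [← he] at h2
      have := h2.1 (h1.2 (by omega))
      omega

theorem IsAnticycle.exists_rel {H : V → V → Prop} {n : ℕ} {w : ℕ → V} (h : IsAnticycle H n w)
    {i : ℕ} (hi : i < n) : ∃ v, H (w i) v ∨ H v (w i) := by
  obtain ⟨hn, h⟩ := h
  by_cases h2 : i + 2 < n
  · exact ⟨_, Or.inl ((h i (i + 2) (by omega) h2).2 (by omega))⟩
  · by_cases h3 : i = 2
    · exact ⟨_, Or.inr ((h 0 i (by omega) (by omega)).2 (by omega))⟩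
    · exact ⟨_, Or.inr ((h 1 i (by omega) (by omega)).2 (by omega))⟩

end Anticycle

/-! ### Even-connection in gap-free graphs. -/

section GapFree

variable {V : Type*} [DecidableEq V] {G : SimpleGraph V} {A : Multiset (Sym2 V)} {p q : V}

/-- Disjoint walks are joined through `pq`. Otherwise the first is cut at its first edge in the
second and continued along the second, to whichever end the orientation permits. -/
theorem EvenConn.concat_or {w w' : V} (h : EvenConn G A w p) (h' : EvenConn G A w' q) :
    EvenConn G (s(p, q) ::ₘ A) w w' ∨ EvenConn G A w q := by
  obtain ⟨D, hD, h⟩ := h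
  obtain ⟨D', hD', h'⟩ := h'
  rcases h.first D' with hdisj | ⟨c, d, C₀, h1, h2, h3, h4⟩
  · left
    refine ⟨_, ?_, h.concat h'.symm⟩
    rw [Multiset.add_cons, Multiset.cons_le_cons_iff]
    exact add_le_of_disjoint hD hD' hdisj
  · obtain ⟨C₁, C₂, rfl, h5 | h5⟩ := h'.split h3
    · right
      refine ⟨_, ?_, h4.concat h5.2⟩
      have h6 : s(c, d) ::ₘ C₂ ≤ C₁ + s(c, d) ::ₘ C₂ := Multiset.le_add_left _ _
      exact add_le_of_disjoint (h1.trans hD) (h6.trans hD') (h2.mono_right h6)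
    · left
      refine EvenConn.mono ⟨_, ?_, h4.concat h5.1.symm⟩ (Multiset.le_cons_self _ _)
      have h6 : s(c, d) ::ₘ C₁ ≤ C₁ + s(c, d) ::ₘ C₂ := by
        rw [Multiset.add_cons, ← Multiset.cons_add]; exact Multiset.le_add_right _ _
      exact add_le_of_disjoint (h1.trans hD) (h6.trans hD') (h2.mono_right h6)

/-- A walk using `pq` is cut there. Otherwise gap-freeness links its first edge to `pq`, either
directly from `z` or at the end of the reversed walk from `z'`. -/
theorem EvenConn.meets (hG : GapFree G) (hpq : G.Adj p q) {z z' : V}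
    (h : EvenConn G (s(p, q) ::ₘ A) z z') :
    (EvenConn G A z p ∨ EvenConn G A z q) ∨ EvenConn G A z' p ∨ EvenConn G A z' q := by
  obtain ⟨C, hC, h⟩ := h
  by_cases hm : s(p, q) ∈ C
  · left
    obtain ⟨C₁, C₂, rfl, h1⟩ := h.split hm
    rw [Multiset.add_cons, Multiset.cons_le_cons_iff] at hC
    have h2 := (Multiset.le_add_right _ _).trans hC
    exact h1.imp (fun h1 => ⟨C₁, h2, h1.1⟩) (fun h1 => ⟨C₁, h2, h1.1⟩)
  · rw [Multiset.le_cons_of_notMem hm] at hC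
    cases h with
    | single h =>
      rcases hG h hpq with h | h | h | h
      · exact Or.inl (Or.inl (.of_adj h))
      · exact Or.inl (Or.inr (.of_adj h))
      · exact Or.inr (Or.inl (.of_adj h))
      · exact Or.inr (Or.inr (.of_adj h))
    | @step _ a b _ C h hC' =>
      have key : ∀ t, G.Adj a t → EvenConn G A z' t := fun t ht =>
        ⟨_, hC, by
          have := hC'.symm.concat (.single ht)
          rwa [Sym2.eq_swap, ← Multiset.singleton_add, add_zero, add_comm,
            Multiset.singleton_add] at this⟩
      rcases hG h hpq with h | h | h | h
      · exact Or.inl (Or.inl (.of_adj h))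
      · exact Or.inl (Or.inr (.of_adj h))
      · exact Or.inr (Or.inl (key _ h))
      · exact Or.inr (Or.inr (key _ h))

/-- A connection that is not an edge begins with an edge of `G` followed by a member of `A`. -/
theorem EvenConn.adj_or {u v : V} (h : EvenConn G A u v) :
    G.Adj u v ∨ ∃ p q A₁, A = s(p, q) ::ₘ A₁ ∧ G.Adj u p ∧ EvenConn G A₁ v q := by
  obtain ⟨C, hC, h⟩ := h
  cases h with
  | single h => exact Or.inl h
  | @step _ p q _ C h h' =>
    obtain ⟨A₁, rfl⟩ := Multiset.exists_cons_of_mem (Multiset.mem_of_le hC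
      (Multiset.mem_cons_self _ _))
    rw [Multiset.cons_le_cons_iff] at hC
    exact Or.inr ⟨p, q, A₁, rfl, h, C, hC, h'.symm⟩

theorem EvenConn.of_adj_of_evenConn {u v : V} (h : G.Adj u p) (h' : EvenConn G A v q) :
    EvenConn G (s(p, q) ::ₘ A) u v := by
  obtain ⟨C, hC, h'⟩ := h'
  exact ⟨_, (Multiset.cons_le_cons_iff _).2 hC, .step h h'.symm⟩

/-- The closed walk at `a` uses some `pq` in `A`; one end of the pair is connected to `p` or `q`,
and then to `a` through `pq`. -/
theorem EvenConn.of_loop (hG : GapFree G) (hA : IsEdges G A) {a c d : V} (ha : EvenConn G A a a)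
    (hcd : EvenConn G A c d) : EvenConn G A a c ∨ EvenConn G A a d := by
  obtain h | ⟨p, q, A₁, rfl, hap, haq⟩ := ha.adj_or
  · exact (h.ne rfl).elim
  have key : ∀ t, EvenConn G A₁ t p ∨ EvenConn G A₁ t q → EvenConn G (s(p, q) ::ₘ A₁) a t := by
    intro t ht
    have h2 : EvenConn G A₁ t q → EvenConn G (s(p, q) ::ₘ A₁) a t := .of_adj_of_evenConn hap
    rcases ht with ht | ht
    · exact (ht.concat_or haq).elim EvenConn.symm h2
    · exact h2 ht
  exact (hcd.meets hG (isEdges_cons.1 hA).1).imp (key _) (key _)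

/-- For a gap-free graph, the anticycles of the relation of being even-connected are anticycles of
the graph. -/
theorem IsAnticycle.of_evenConn (hG : GapFree G) (hA : IsEdges G A) {n : ℕ} {w : ℕ → V}
    (hw : IsAnticycle (EvenConn G A) n w) : IsAnticycle G.Adj n w := by
  have hw' := hw.2
  have hn := hw.1
  refine ⟨hn, fun i j hij hj => ⟨fun h => (hw' i j hij hj).1 (.of_adj h), fun h => ?_⟩⟩
  by_contra hnadj
  have huv := (hw' i j hij hj).2 h
  obtain h0 | ⟨p, q, A₁, rfl, hup, hvq⟩ := huv.adj_or
  · exact hnadj h0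
  have hpq := (isEdges_cons.1 hA).1
  -- This property passes between consecutive vertices of the anticycle as long as the next one is
  -- connected to `p` or `q`. It holds at `w i` and fails at `w j`, so both arcs between them
  -- contain a vertex connected to neither.
  let P : V → Prop := fun x => EvenConn G A₁ x p ∧ ¬ EvenConn G A₁ x q
  have hP : ∀ x y, P x → ¬ EvenConn G (s(p, q) ::ₘ A₁) x y →
      (EvenConn G A₁ y p ∨ EvenConn G A₁ y q) → P y := by
    intro x y hx hxy hy
    have : ¬ EvenConn G A₁ y q := fun h => (hx.1.concat_or h).elim hxy hx.2
    exact ⟨hy.resolve_right this, this⟩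
  have hPi : P (w i) := ⟨.of_adj hup, fun h => by
    have := (hw' i i le_rfl (by omega)).1 (.of_adj_of_evenConn hup h)
    omega⟩
  have hPj : ¬ P (w j) := fun h => h.2 hvq
  obtain ⟨t, ht1, ht2, ht3⟩ : ∃ t, i < t ∧ t < j ∧
      ¬ (EvenConn G A₁ (w t) p ∨ EvenConn G A₁ (w t) q) := by
    by_contra! hno
    refine hPj (Nat.le_induction (P := fun t _ => t ≤ j → P (w t)) (fun _ => hPi) ?_ j hij le_rfl)
    intro t hit ih htj
    refine hP (w t) _ (ih (by omega)) (fun h => ?_) ?_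
    · have := (hw' t (t + 1) (by omega) (by omega)).1 h
      omega
    · rcases htj.lt_or_eq with h | h
      · exact hno (t + 1) (by omega) h
      · exact Or.inr (h ▸ hvq)
  obtain ⟨t', ht'1, ht'2, ht'3⟩ : ∃ t, (t < i ∨ j < t) ∧ t < n ∧
      ¬ (EvenConn G A₁ (w t) p ∨ EvenConn G A₁ (w t) q) := by
    by_contra! hno
    have h1 : ∀ e, e ≤ i → P (w (i - e)) := by
      intro e
      induction e with
      | zero => exact fun _ => hPi
      | succ e ih =>
        intro he
        refine hP _ _ (ih (by omega)) (fun h => ?_) (hno _ (by omega) (by omega))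
        have := (hw' (i - (e + 1)) (i - e) (by omega) (by omega)).1 h.symm
        omega
    have h2 : P (w 0) := by simpa using h1 i le_rfl
    have h3 : ∀ t, j ≤ t → t < n → (EvenConn G A₁ (w t) p ∨ EvenConn G A₁ (w t) q) := by
      intro t ht htn
      rcases ht.lt_or_eq with h | h
      · exact hno t (Or.inr h) htn
      · exact Or.inr (h ▸ hvq)
    have h4 : ∀ e, e + j < n → P (w (n - 1 - e)) := by
      intro e
      induction e with
      | zero =>
        intro he
        refine hP _ _ h2 (fun h => ?_) (h3 _ (by omega) (by omega))
        have := (hw' 0 (n - 1 - 0) (by omega) (by omega)).1 h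
        omega
      | succ e ih =>
        intro he
        refine hP _ _ (ih (by omega)) (fun h => ?_) (h3 _ (by omega) (by omega))
        have := (hw' (n - 1 - (e + 1)) (n - 1 - e) (by omega) (by omega)).1 h.symm
        omega
    refine hPj ?_
    have := h4 (n - 1 - j) (by omega)
    rwa [show n - 1 - (n - 1 - j) = j by omega] at this
  -- The two exceptional vertices are interior to opposite arcs, hence not consecutive, hence
  -- connected; this contradicts `EvenConn.meets`.
  have hzz : EvenConn G (s(p, q) ::ₘ A₁) (w t) (w t') := by
    rcases ht'1 with h | h
    · exact ((hw' t' t (by omega) (by omega)).2 (by omega)).symm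
    · exact (hw' t t' (by omega) (by omega)).2 (by omega)
  exact (hzz.meets hG hpq).elim ht3 ht'3

end GapFree

/-! ### Vertices whose non-neighbours are independent -/

section Dirac

variable {V : Type*} {H : V → V → Prop}

/-- A path, in the complement of `H`, from `s` to `t` through vertices related to `a`. -/
def IsPathThrough (H : V → V → Prop) (Y : Set V) (a s t : V) (m : ℕ) (q : ℕ → V) : Prop :=
  q 0 = s ∧ q m = t ∧ (∀ i < m, ¬ H (q i) (q (i + 1))) ∧ ∀ i, 0 < i → i < m → q i ∈ Y ∧ H a (q i)

/-- A shortest such path has no chord in the complement, and `a` is joined there only to its two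
ends; so `a` closes it to an induced cycle. -/
theorem exists_isAnticycle_of_path {Y : Set V} (hloop : ∀ y ∈ Y, ¬ H y y) {a s t : V} (ha : a ∈ Y)
    (hs : s ∈ Y) (ht : t ∈ Y) (hst : H s t) (has : ¬ H a s) (hat : ¬ H a t)
    (hpath : ∃ m q, IsPathThrough H Y a s t m q) :
    ∃ n w, (∀ i < n, w i ∈ Y) ∧ IsAnticycle H n w := by
  classical
  obtain ⟨q, hq0, hqm, hq, hin⟩ := Nat.find_spec hpath
  have hmin := fun m' (h : m' < Nat.find hpath) => Nat.find_min hpath h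
  set m := Nat.find hpath
  have hm0 : m ≠ 0 := by
    intro h0
    rw [h0, hq0] at hqm
    subst hqm
    exact hloop s hs hst
  have hm1 : m ≠ 1 := by
    intro h1
    have := hq 0 (by omega)
    rw [hq0, zero_add, ← h1, hqm] at this
    exact this hst
  have hY : ∀ i ≤ m, q i ∈ Y := by
    intro i hi
    rcases Nat.eq_zero_or_pos i with h | h
    · rw [h, hq0]; exact hs
    · rcases hi.lt_or_eq with h' | h'
      · exact (hin i h h').1
      · rw [h', hqm]; exact ht
  let w : ℕ → V := fun i => match i with | 0 => a | i + 1 => q i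
  refine ⟨m + 2, w, ?_, by omega, ?_⟩
  · rintro (_ | i) hi
    · exact ha
    · exact hY i (by omega)
  · rintro (_ | i) (_ | j) hij hj
    · simpa [w] using hloop a ha
    · change H a (q j) ↔ _
      rcases Nat.eq_zero_or_pos j with h | h
      · subst h; rw [hq0]; simp [has]
      · by_cases h' : j = m
        · subst h'; rw [hqm]; simp [hat]
        · simp only [(hin j h (by omega)).2, true_iff]; omega
    · omega
    · change H (q i) (q j) ↔ _
      rcases Nat.lt_trichotomy j (i + 1) with h | h | h
      · have : j = i := by omega
        subst this
        simpa using hloop _ (hY j (by omega))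
      · subst h
        simpa using hq i (by omega)
      · refine iff_of_true ?_ (by omega)
        by_contra hno
        -- The chord skips the `j - i - 1` vertices strictly between `q i` and `q j`.
        refine hmin (m - (j - i - 1)) (by omega)
          ⟨fun l => if l ≤ i then q l else q (l + (j - i - 1)), ?_, ?_, ?_, ?_⟩
        · simpa using hq0
        · dsimp only
          rw [if_neg (by omega), Nat.sub_add_cancel (by omega)]; exact hqm
        · intro l hl
          dsimp only
          rcases Nat.lt_trichotomy l i with h1 | h1 | h1
          · rw [if_pos (by omega), if_pos (by omega)]; exact hq l (by omega)
          · subst h1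
            rw [if_pos le_rfl, if_neg (by omega), show l + 1 + (j - l - 1) = j by omega]
            exact hno
          · rw [if_neg (by omega), if_neg (by omega), add_right_comm]
            exact hq _ (by omega)
        · intro l hl0 hl
          dsimp only
          split_ifs
          · exact hin l hl0 (by omega)
          · exact hin _ (by omega) (by omega)

theorem exists_path_of_reflTransGen {Z : Set V} {b c : V} (hb : b ∈ Z)
    (h : Relation.ReflTransGen (fun y y' => y ∈ Z ∧ y' ∈ Z ∧ ¬ H y y') b c) :
    ∃ (m : ℕ) (q : ℕ → V), q 0 = b ∧ q m = c ∧ (∀ i < m, ¬ H (q i) (q (i + 1))) ∧ ∀ i ≤ m, q i ∈ Z := by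
  induction h with
  | refl => exact ⟨0, fun _ => b, rfl, rfl, by simp, fun _ _ => hb⟩
  | @tail c d _ hcd ih =>
    obtain ⟨m, q, h0, hm, hq, hz⟩ := ih
    refine ⟨m + 1, fun i => if i ≤ m then q i else d, by simpa using h0, by simp, ?_, ?_⟩
    · intro i hi
      dsimp only
      rcases Nat.lt_or_ge i m with h | h
      · rw [if_pos h.le, if_pos (by omega)]; exact hq i h
      · have : i = m := by omega
        subst this
        rw [if_pos le_rfl, if_neg (by omega), hm]
        exact hcd.2.2
    · intro i hi
      dsimp only
      split_ifs with h
      · exact hz i h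
      · exact hcd.2.1

/-- In a finite set without loops and without anticycles, every vertex `a` with a neighbour has a
neighbour whose non-neighbours are pairwise not related. -/
theorem exists_cosimplicial_of_rel [DecidableEq V] (hH : ∀ u v, H u v → H v u) (Y : Finset V)
    (hloop : ∀ y ∈ Y, ¬ H y y) (hno : ∀ n w, (∀ i < n, w i ∈ Y) → ¬ IsAnticycle H n w)
    {a b₀ : V} (ha : a ∈ Y) (hb₀ : b₀ ∈ Y) (hab₀ : H a b₀) :
    ∃ x ∈ Y, H a x ∧ ∀ y ∈ Y, ∀ z ∈ Y, ¬ H x y → ¬ H x z → ¬ H y z := by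
  classical
  induction hn : Y.card using Nat.strong_induction_on generalizing Y a b₀ with
  | _ n ih =>
    let Z : Set V := {y | y ∈ Y ∧ H a y}
    let R : V → V → Prop := fun y y' => y ∈ Z ∧ y' ∈ Z ∧ ¬ H y y'
    have hRsymm : Std.Symm R := ⟨fun y y' h => ⟨h.2.1, h.1, fun h' => h.2.2 (hH _ _ h')⟩⟩
    -- In the complement, `B` is a component of the vertices not joined to `a`, and `S` below is the
    -- set of neighbours of `a` that touch it: a separator, which must be a clique of the
    -- complement.
    let B : Finset V := Y.filter fun y => Relation.ReflTransGen R b₀ y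
    have hBZ : ∀ y, Relation.ReflTransGen R b₀ y → y ∈ Z := by
      intro y hy
      induction hy with
      | refl => exact ⟨hb₀, hab₀⟩
      | tail _ h _ => exact h.2.1
    have hmemB : ∀ y, y ∈ B ↔ Relation.ReflTransGen R b₀ y := fun y => by
      simp only [B, Finset.mem_filter, and_iff_right_iff_imp]
      exact fun h => (hBZ y h).1
    have hBa : ∀ y ∈ B, H a y := fun y hy => (hBZ y ((hmemB y).1 hy)).2
    let S : Finset V := Y.filter fun y => ¬ H a y ∧ ∃ b ∈ B, ¬ H y b
    have hb₀B : b₀ ∈ B := (hmemB b₀).2 .refl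
    have haS : a ∉ S := by
      intro h
      obtain ⟨-, -, b, hb, hab⟩ := Finset.mem_filter.1 h
      exact hab (hBa b hb)
    have hS : ∀ s ∈ S, ∀ t ∈ S, ¬ H s t := by
      intro s hs t ht hst
      obtain ⟨hsY, has, b, hb, hsb⟩ := Finset.mem_filter.1 hs
      obtain ⟨htY, hat, c, hc, htc⟩ := Finset.mem_filter.1 ht
      have hbc : Relation.ReflTransGen R b c :=
        ((Relation.ReflTransGen.stdSymm (r := R)).symm _ _ ((hmemB b).1 hb)).trans ((hmemB c).1 hc)
      obtain ⟨m, q, h0, hm, hq, hz⟩ := exists_path_of_reflTransGen (hBZ b ((hmemB b).1 hb)) hbc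
      obtain ⟨n, w, h1, h2⟩ := exists_isAnticycle_of_path (Y := (Y : Set V)) (a := a) (s := s)
        (t := t) hloop ha hsY htY hst has hat
        ⟨m + 2, fun i => if i = 0 then s else if i ≤ m + 1 then q (i - 1) else t, by simp, by simp,
          fun i hi => by
            rcases Nat.eq_zero_or_pos i with h | h
            · subst h; simpa [h0] using hsb
            · dsimp only
              rcases Nat.lt_or_ge i (m + 1) with h' | h'
              · rw [if_neg (by omega), if_pos (by omega), if_neg (by omega), if_pos (by omega)]
                have := hq (i - 1) (by omega)
                rwa [Nat.sub_add_cancel h] at this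
              · have : i = m + 1 := by omega
                subst this
                simp only [Nat.add_eq_zero_iff, one_ne_zero, and_false, if_false, le_refl, if_true,
                  Nat.add_sub_cancel, hm]
                rw [if_neg (by omega)]
                exact fun h => htc (hH _ _ h),
          fun i hi0 hi => by
            dsimp only
            rw [if_neg (by omega), if_pos (by omega)]
            exact hz _ (by omega)⟩
      exact hno n w h1 h2
    have hY' : B ∪ S ⊆ Y := Finset.union_subset (Finset.filter_subset _ _)
      (Finset.filter_subset _ _)
    have haB : a ∉ B := fun h => hloop a ha (hBa a h)
    have hcard : (B ∪ S).card < n := by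
      rw [← hn]
      refine Finset.card_lt_card ⟨hY', fun h => ?_⟩
      exact (Finset.mem_union.1 (h ha)).elim haB haS
    have hnbr : ∀ x ∈ B, ∀ y ∈ Y, ¬ H x y → y ∈ B ∪ S := by
      intro x hx y hy hxy
      by_cases hay : H a y
      · exact Finset.mem_union_left _ ((hmemB y).2
          (((hmemB x).1 hx).tail ⟨hBZ x ((hmemB x).1 hx), ⟨hy, hay⟩, hxy⟩))
      · exact Finset.mem_union_right _ (Finset.mem_filter.2 ⟨hy, hay, x, hx,
          fun h => hxy (hH _ _ h)⟩)
    -- Prescribing a neighbour of `x` in the induction forces `x` into `B`: a vertex related to a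
    -- member of `S` is outside `S`. If no member of `S` is related to anything, any relation found
    -- lies within `B`.
    obtain ⟨x, hxB, hx⟩ : ∃ x ∈ B, ∀ y ∈ B ∪ S, ∀ z ∈ B ∪ S, ¬ H x y → ¬ H x z → ¬ H y z := by
      have ih' := fun a b => @ih _ hcard (B ∪ S) (fun y hy => hloop y (hY' hy))
        (fun n w h => hno n w fun i hi => hY' (h i hi)) a b
      by_cases h1 : ∃ s ∈ S, ∃ y ∈ B ∪ S, H s y
      · obtain ⟨s, hs, y, hy, hsy⟩ := h1
        obtain ⟨x, hx, hsx, hx'⟩ := ih' s y (Finset.mem_union_right _ hs) hy hsy rfl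
        exact ⟨x, (Finset.mem_union.1 hx).resolve_right fun h => hS s hs x h hsx, hx'⟩
      by_cases h2 : ∃ b ∈ B, ∃ y ∈ B ∪ S, H b y
      · obtain ⟨b, hb, y, hy, hby⟩ := h2
        obtain ⟨x, hx, hbx, hx'⟩ := ih' b y (Finset.mem_union_left _ hb) hy hby rfl
        refine ⟨x, (Finset.mem_union.1 hx).resolve_right fun h => h1 ⟨x, h, b, ?_, hH _ _ hbx⟩, hx'⟩
        exact Finset.mem_union_left _ hb
      · refine ⟨b₀, hb₀B, fun y hy z hz _ _ hyz => ?_⟩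
        rcases Finset.mem_union.1 hy with h | h
        · exact h2 ⟨y, h, z, hz, hyz⟩
        · exact h1 ⟨y, h, z, hz, hyz⟩
    exact ⟨x, (Finset.mem_filter.1 hxB).1, hBa x hxB, fun y hy z hz hxy hxz =>
      hx y (hnbr x hxB y hy hxy) z (hnbr x hxB z hz hxz) hxy hxz⟩

theorem exists_cosimplicial [DecidableEq V] (hH : ∀ u v, H u v → H v u) {Y : Finset V}
    (hY : Y.Nonempty) (hloop : ∀ y ∈ Y, ¬ H y y)
    (hno : ∀ n w, (∀ i < n, w i ∈ Y) → ¬ IsAnticycle H n w) :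
    ∃ x ∈ Y, ∀ y ∈ Y, ∀ z ∈ Y, ¬ H x y → ¬ H x z → ¬ H y z := by
  by_cases h : ∃ a ∈ Y, ∃ b ∈ Y, H a b
  · obtain ⟨a, ha, b, hb, hab⟩ := h
    obtain ⟨x, hx, -, hx'⟩ := exists_cosimplicial_of_rel hH Y hloop hno ha hb hab
    exact ⟨x, hx, hx'⟩
  · push Not at h
    obtain ⟨x, hx⟩ := hY
    exact ⟨x, hx, fun y hy z hz _ _ => h y hy z hz⟩

end Dirac

end EdgePower

/-! ### Regularity two and anticycles -/

namespace EdgePower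

open Finset SimplicialKoszul

section Homology

variable {k : Type*} [Field k] {V : Type*} [LinearOrder V] [Fintype V] {G : SimpleGraph V}

theorem ind_mem_powerSet_one {ρ : Finset V} :
    ind ρ ∈ powerSet G 1 ↔ ∃ u ∈ ρ, ∃ v ∈ ρ, G.Adj u v := by
  constructor
  · rintro ⟨B, hB, hc, hle⟩
    obtain ⟨e, rfl⟩ := Multiset.card_eq_one.1 hc
    induction e using Sym2.ind with
    | h a b =>
      rw [← Multiset.cons_zero] at hB hle
      have h1 := hle a
      have h2 := hle b
      rw [degs_cons_apply, ind_apply] at h1 h2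
      refine ⟨a, ?_, b, ?_, (isEdges_cons.1 hB).1⟩
      · by_contra h; simp [h] at h1
      · by_contra h; simp [h] at h2
  · rintro ⟨u, hu, v, hv, huv⟩
    refine ⟨{s(u, v)}, by simpa [IsEdges] using huv, by simp, fun x => ?_⟩
    rw [← Multiset.cons_zero, degs_cons_apply, ind_apply]
    have := huv.ne
    by_cases h1 : u = x
    · subst h1; simp [hu, this.symm]
    · by_cases h2 : v = x
      · subst h2; simp [hv, h1]
      · simp [h1, h2]

theorem ind_sub_ind {σ τ : Finset V} : ind σ - ind τ = ind (σ \ τ) := by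
  ext x
  rw [Finsupp.tsub_apply, ind_apply, ind_apply, ind_apply]
  by_cases h1 : x ∈ σ <;> by_cases h2 : x ∈ τ <;> simp [h1, h2]

/-- If the edge ideal has regularity at most two, then the graph has no anticycle. -/
theorem not_isAnticycle_of_regLE (h : RegLE k (powerSet G 1) 2) (n : ℕ) (w : ℕ → V) :
    ¬ IsAnticycle G.Adj n w := by
  intro hw
  have hn := hw.1
  have hinj : ∀ i < n, ∀ j < n, w i = w j → i = j := by
    intro i hi j hj hij
    rcases Nat.lt_trichotomy i j with h1 | h1 | h1
    · exact (hw.ne (fun _ _ h => h.symm) h1 hj hij).elim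
    · exact h1
    · exact (hw.ne (fun _ _ h => h.symm) h1 hi hij.symm).elim
  obtain ⟨W, hW⟩ : ∃ W : Finset V, W = (range n).image w := ⟨_, rfl⟩
  have hwW : ∀ i < n, w i ∈ W := fun i hi => hW ▸ mem_image_of_mem w (mem_range.2 hi)
  have hcard : W.card = n := by
    rw [hW, card_image_of_injOn, card_range]
    intro i hi j hj
    exact hinj i (by simpa using hi) j (by simpa using hj)
  obtain ⟨l, rfl⟩ : ∃ l, n = l + 3 := ⟨n - 3, by omega⟩
  let 𝒟 : Set (Finset V) := {τ | ind τ ≤ ind W ∧ ind W - ind τ ∉ powerSet G 1}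
  have h𝒟 : ∀ τ, τ ∈ 𝒟 ↔ τ ⊆ W ∧ ∀ u ∈ W \ τ, ∀ v ∈ W \ τ, ¬ G.Adj u v := by
    intro τ
    simp only [𝒟, Set.mem_ofPred_eq, ind_le_ind, ind_sub_ind, ind_mem_powerSet_one]
    push Not
    rfl
  have hext : IsExtension {τ | ind τ ≤ ind W} (face (powerSet G 1) (ind W)) 𝒟 := by
    refine ⟨(isLowerSet_simplex _).ordConnected, ?_, ?_⟩
    · ext τ
      simp only [face, 𝒟, Set.mem_union, Set.mem_ofPred_eq]
      tauto
    · intro σ hσ τ hτ hle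
      exact hτ.2 (isLowerSet_face (isUpperSet_powerSet G 1) _ hle hσ).2
  -- The hypothesis applies in size `l` as `(l + 3) - l > 2`. In the quotient, sets of size `l + 1`
  -- are complements of independent pairs, the edges of the complementary cycle.
  have hacyc : Acyc k 𝒟 (l + 1) := hext.acyc_right (acyc_simplex_succ _ _)
    (h _ _ (by rw [degree_ind, hcard]; push_cast; linarith))
  let T : V → V → Finset V := fun p q => (W.erase p).erase q
  -- This is the cochain supported on one edge of that cycle, closed because no independent triple
  -- contains the edge.
  let c : Finset V → k := fun τ => if τ = T (w 0) (w 1) then 1 else 0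
  have hT : ∀ p ∈ W, ∀ q ∈ W, p ≠ q → ¬ G.Adj p q → T p q ∈ 𝒟 := by
    intro p hp q hq hpq hadj
    have hqp := fun h : G.Adj q p => hadj h.symm
    rw [h𝒟]
    refine ⟨(erase_subset _ _).trans (erase_subset _ _), fun u hu v hv => ?_⟩
    simp only [T, mem_sdiff, mem_erase, not_and_or, not_not] at hu hv
    have hu' : u = q ∨ u = p := by tauto
    have hv' : v = q ∨ v = p := by tauto
    rcases hu' with h1 | h1 <;> rcases hv' with h2 | h2 <;> rw [h1, h2]
    · exact G.irrefl
    · exact hqp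
    · exact hadj
    · exact G.irrefl
  have h01 : w 0 ≠ w 1 := fun h => by simpa using hinj 0 (by omega) 1 (by omega) h
  have hadj01 : ¬ G.Adj (w 0) (w 1) := fun h => by
    have := (hw.2 0 1 (by omega) (by omega)).1 h
    omega
  obtain ⟨c', hc', hb⟩ := hacyc c
    (by
      intro τ hτ
      have : τ = T (w 0) (w 1) := by
        by_contra h0; simp [c, h0] at hτ
      subst this
      refine ⟨hT _ (hwW 0 (by omega)) _ (hwW 1 (by omega)) h01 hadj01, ?_⟩
      rw [card_erase_of_mem (mem_erase.2 ⟨h01.symm, hwW 1 (by omega)⟩),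
        card_erase_of_mem (hwW 0 (by omega)), hcard]
      omega)
    (by
      intro τ hτ
      refine bd_eq_zero_of_forall fun v hv => if_neg fun h0 => ?_
      have hv' : v ∈ T (w 0) (w 1) := h0 ▸ mem_insert_self v τ
      simp only [T, mem_erase] at hv'
      obtain ⟨hv1, hv0, hvW⟩ := hv'
      have hnot : ∀ x, x ∉ T (w 0) (w 1) → x ∉ τ := fun x hx hxτ =>
        hx (h0 ▸ mem_insert_of_mem hxτ)
      have hind := ((h𝒟 τ).1 hτ).2
      rw [hW] at hvW
      obtain ⟨t, ht, rfl⟩ := mem_image.1 hvW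
      rw [mem_range] at ht
      have ht0 : t ≠ 0 := fun h => hv0 (h ▸ rfl)
      have ht1 : t ≠ 1 := fun h => hv1 (h ▸ rfl)
      by_cases ht2 : t + 1 = l + 3
      · exact hind (w 1) (mem_sdiff.2 ⟨hwW 1 (by omega), hnot _ (by simp [T])⟩) (w t)
          (mem_sdiff.2 ⟨hwW t ht, hv⟩) ((hw.2 1 t (by omega) ht).2 (by omega))
      · exact hind (w 0) (mem_sdiff.2 ⟨hwW 0 (by omega), hnot _ (by simp [T])⟩) (w t)
          (mem_sdiff.2 ⟨hwW t ht, hv⟩) ((hw.2 0 t (by omega) ht).2 (by omega)))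
  -- Up to sign, the filling is a function on the vertices whose differences along edges are given
  -- by `c`.
  let γ : V → k := fun p => sgn k p (W.erase p) * c' (W.erase p)
  have hstep : ∀ p ∈ W, ∀ q ∈ W, p ≠ q → ¬ G.Adj p q →
      γ q - γ p = (sgn k p (T p q) * sgn k q (insert p (T p q))) * c (T p q) := by
    intro p hp q hq hpq hadj
    have hTm := hT p hp q hq hpq hadj
    have hpT : p ∉ T p q := by simp [T]
    have hqT : q ∉ T p q := by simp [T]
    have e1 : insert q (T p q) = W.erase p := insert_erase (mem_erase.2 ⟨hpq.symm, hq⟩)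
    have e2 : insert p (T p q) = W.erase q := by
      rw [show T p q = (W.erase q).erase p from erase_right_comm]
      exact insert_erase (mem_erase.2 ⟨hpq, hp⟩)
    have hbd : bd c' (T p q) =
        sgn k p (T p q) * c' (W.erase q) + sgn k q (T p q) * c' (W.erase p) := by
      rw [bd, sum_eq_add p q hpq, e1, e2]
      · intro v _ hv
        rw [hc'.eq_zero, mul_zero]
        intro h1
        have h2 := ((h𝒟 _).1 h1).1 (mem_insert_self v _)
        have h3 := mem_compl.1 (by assumption : v ∈ (T p q)ᶜ)
        simp only [T, mem_erase] at h3
        tauto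
      · intro h1; exact (h1 (mem_compl.2 hpT)).elim
      · intro h1; exact (h1 (mem_compl.2 hqT)).elim
    rw [hb _ hTm] at hbd
    have hs := sgn_swap k hpT hqT hpq
    have hs1 := sgn_mul_self k p (T p q)
    have hs2 := sgn_mul_self k q (T p q)
    simp only [γ]
    rw [hbd, ← e1, ← e2]
    linear_combination (-(sgn k q (insert p (T p q)) * c' (insert p (T p q)))) * hs1 +
      (-(sgn k q (T p q) * c' (insert q (T p q)))) * hs +
      (sgn k p (insert q (T p q)) * c' (insert q (T p q))) * hs2
  have hzero : ∀ p ∈ W, ∀ q ∈ W, p ≠ q → ¬ G.Adj p q →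
      (q ≠ w 0 ∧ q ≠ w 1 ∨ p ≠ w 0 ∧ p ≠ w 1) → γ q = γ p := by
    intro p hp q hq hpq hadj hne
    have h1 := hstep p hp q hq hpq hadj
    have h2 : c (T p q) = 0 := by
      refine if_neg fun h0 => ?_
      rcases hne with h | h
      · have : q ∈ T (w 0) (w 1) := mem_erase.2 ⟨h.2, mem_erase.2 ⟨h.1, hq⟩⟩
        rw [← h0] at this
        simp [T] at this
      · have : p ∈ T (w 0) (w 1) := mem_erase.2 ⟨h.2, mem_erase.2 ⟨h.1, hp⟩⟩
        rw [← h0] at this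
        simp [T] at this
    rw [h2, mul_zero] at h1
    exact sub_eq_zero.1 h1
  have hchain : ∀ t, t + 1 < l + 3 → γ (w (t + 1)) = γ (w 1) := by
    intro t
    induction t with
    | zero => intro _; rfl
    | succ t ih =>
      intro ht
      rw [← ih (by omega)]
      refine hzero _ (hwW _ (by omega)) _ (hwW _ ht) ?_ ?_ (Or.inl ⟨?_, ?_⟩)
      · intro h0; have := hinj _ (by omega) _ (by omega) h0; omega
      · intro h0; have := (hw.2 (t + 1) (t + 1 + 1) (by omega) (by omega)).1 h0; omega
      · intro h0; have := hinj _ (by omega) _ (by omega) h0; omega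
      · intro h0; have := hinj _ (by omega) _ (by omega) h0; omega
  have hlast : γ (w 0) = γ (w (l + 1 + 1)) := by
    refine hzero _ (hwW _ (by omega)) _ (hwW _ (by omega)) ?_ ?_ (Or.inr ⟨?_, ?_⟩)
    · intro h0; have := hinj _ (by omega) _ (by omega) h0; omega
    · intro h0; have := (hw.2 0 (l + 1 + 1) (by omega) (by omega)).1 h0.symm; omega
    · intro h0; have := hinj _ (by omega) _ (by omega) h0; omega
    · intro h0; have := hinj _ (by omega) _ (by omega) h0; omega
  -- Around the cycle `γ` is constant along every edge but this one, where it would have to jump by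
  -- a sign.
  have hfirst := hstep (w 0) (hwW 0 (by omega)) (w 1) (hwW 1 (by omega)) h01 hadj01
  rw [hlast, hchain (l + 1) (by omega), sub_self, show c (T (w 0) (w 1)) = 1 from if_pos rfl,
    mul_one] at hfirst
  have h3 := sgn_mul_self k (w 0) (T (w 0) (w 1))
  have h4 := sgn_mul_self k (w 1) (insert (w 0) (T (w 0) (w 1)))
  rcases mul_eq_zero.1 hfirst.symm with h5 | h5
  · simp [h5] at h3
  · simp [h5] at h4

/-- The edge ideal of a graph with an edge has regularity at least two. -/
theorem two_le_of_regLE {r : ℤ} (h : RegLE k (powerSet G 1) r) {u v : V} (huv : G.Adj u v) :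
    2 ≤ r := by
  by_contra! hr
  have hdeg : ((ind {u, v} : V →₀ ℕ).degree) = 2 := by
    rw [degree_ind, card_pair huv.ne]
  -- In the degree of an edge the complex is only the empty face, which represents a minimal
  -- generator.
  have hmem : ∀ τ, τ ∈ face (powerSet G 1) (ind {u, v}) → τ = ∅ := by
    rintro τ ⟨h1, h2⟩
    rw [ind_sub_ind, ind_mem_powerSet_one] at h2
    rw [ind_le_ind] at h1
    obtain ⟨a, ha, b, hb, hab⟩ := h2
    simp only [mem_sdiff, mem_insert, mem_singleton] at ha hb
    refine eq_empty_of_forall_notMem fun x hx => ?_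
    have := h1 hx
    simp only [mem_insert, mem_singleton] at this
    have hne := hab.ne
    rcases ha with ⟨rfl | rfl, ha⟩ <;> rcases hb with ⟨rfl | rfl, hb⟩ <;>
      rcases this with rfl | rfl <;> simp_all
  have hempty : (∅ : Finset V) ∈ face (powerSet G 1) (ind {u, v}) := by
    refine ⟨by simp [ind], ?_⟩
    rw [ind_sub_ind, ind_mem_powerSet_one]
    exact ⟨u, by simp, v, by simp, huv⟩
  obtain ⟨c', hc', hb⟩ := h (ind {u, v}) 0 (by rw [hdeg]; push_cast; linarith)
    (fun τ => if τ = ∅ then 1 else 0) (fun τ hτ => by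
      have : τ = ∅ := by by_contra h0; simp [h0] at hτ
      subst this
      exact ⟨hempty, rfl⟩) (fun τ hτ => bd_eq_zero_of_forall fun x _ => by simp)
  have h1 := hb ∅ hempty
  rw [bd_eq_zero_of_forall fun x _ => hc'.eq_zero fun h2 => by
    have := hmem _ h2
    simp at this] at h1
  simp at h1

end Homology

/-! ### The bound for graphs that reduce to graphs without anticycles -/

/-- After removing the closed neighbourhoods of any `r` successive non-isolated vertices, the
graph has no anticycle. -/
def Good {V : Type*} : ℕ → SimpleGraph V → Prop
  | 0, G => ∀ n w, ¬ IsAnticycle G.Adj n w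
  | r + 1, G => ∀ x y, G.Adj x y → Good r (restrict G {y | y ≠ x ∧ ¬ G.Adj x y})

/-- Needed because the induction discards all vertices even-connected to `x`, not just its
neighbours. Vertices of an anticycle are never isolated, so they lie in `W`. -/
theorem Good.restrict {V : Type*} {r : ℕ} {G : SimpleGraph V} (h : Good r G) (W : Set V) :
    Good r (restrict G W) := by
  induction r generalizing G W with
  | zero =>
    intro n w hw
    have hmem : ∀ i < n, w i ∈ W := fun i hi => by
      obtain ⟨v, hv | hv⟩ := hw.exists_rel hi
      · exact hv.2.1
      · exact hv.2.2
    refine h n w ⟨hw.1, fun i j hij hj => ?_⟩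
    rw [← hw.2 i j hij hj]
    exact ⟨fun h => ⟨h, hmem i (by omega), hmem j hj⟩, fun h => h.1⟩
  | succ r ih =>
    intro x y hxy
    have := ih (h x y hxy.1) W
    convert this using 1
    ext u v
    have hx := hxy.2.1
    simp only [EdgePower.restrict, Set.mem_ofPred_eq]
    tauto

/-- Isolated vertices do not affect `Good`; this relates deletion, which shrinks the vertex type, to
`restrict`, which keeps it. -/
theorem Good.map {V V' : Type*} {r : ℕ} {G : SimpleGraph V} {G' : SimpleGraph V'} (h : Good r G')
    {φ : V' → V} (hφ : Function.Injective φ)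
    (hG : ∀ u v, G.Adj u v ↔ ∃ u' v', φ u' = u ∧ φ v' = v ∧ G'.Adj u' v') : Good r G := by
  have hadj : ∀ u v, G.Adj (φ u) (φ v) ↔ G'.Adj u v := by
    intro u v
    rw [hG]
    constructor
    · rintro ⟨u', v', h1, h2, h3⟩
      rwa [← hφ h1, ← hφ h2]
    · exact fun h => ⟨u, v, rfl, rfl, h⟩
  induction r generalizing G G' with
  | zero =>
    intro n w hw
    have hmem : ∀ i < n, ∃ x, φ x = w i := fun i hi => by
      obtain ⟨v, hv | hv⟩ := hw.exists_rel hi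
      · obtain ⟨u', -, h1, -⟩ := (hG _ _).1 hv
        exact ⟨u', h1⟩
      · obtain ⟨-, v', -, h1, -⟩ := (hG _ _).1 hv
        exact ⟨v', h1⟩
    have : Nonempty V' := ⟨(hmem 0 (by have := hw.1; omega)).choose⟩
    have hinv : ∀ i < n, φ (Function.invFun φ (w i)) = w i := fun i hi =>
      Function.invFun_eq (hmem i hi)
    refine h n (fun i => Function.invFun φ (w i)) ⟨hw.1, fun i j hij hj => ?_⟩
    rw [← hw.2 i j hij hj, ← hadj, hinv i (by omega), hinv j hj]
  | succ r ih =>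
    intro x y hxy
    obtain ⟨x', y', rfl, rfl, hxy'⟩ := (hG x y).1 hxy
    refine ih (h x' y' hxy') ?_ ?_
    · intro u v
      constructor
      · rintro ⟨h1, h2, h3⟩
        obtain ⟨u', v', rfl, rfl, h4⟩ := (hG u v).1 h1
        refine ⟨u', v', rfl, rfl, h4, ⟨?_, ?_⟩, ?_, ?_⟩
        · rintro rfl; exact h2.1 rfl
        · exact fun h5 => h2.2 ((hadj _ _).2 h5)
        · rintro rfl; exact h3.1 rfl
        · exact fun h5 => h3.2 ((hadj _ _).2 h5)
      · rintro ⟨u', v', rfl, rfl, h1, h2, h3⟩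
        exact ⟨(hadj _ _).2 h1, ⟨fun h4 => h2.1 (hφ h4), fun h4 => h2.2 ((hadj _ _).1 h4)⟩,
          fun h4 => h3.1 (hφ h4), fun h4 => h3.2 ((hadj _ _).1 h4)⟩
    · intro u v
      simp only [EdgePower.restrict, Set.mem_ofPred_eq, hadj, hφ.ne_iff]

section Bound

variable {k : Type*} [Field k] {V : Type*} [LinearOrder V] [Fintype V] {G : SimpleGraph V}

/-- At a vertex whose non-neighbours are pairwise unrelated the colon is generated by variables. A
vertex with a loop is of this kind; without loops, `exists_cosimplicial` provides one. -/
theorem regLE_quadric_of_no_anticycle (hG : ∀ n w, ¬ IsAnticycle G.Adj n w)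
    {A : Multiset (Sym2 V)} (hA : IsEdges G A) (Y : Finset V) :
    RegLE k (quadric (EvenConn G A) Y) 2 := by
  have hgap := gapFree_of_forall_not_isAnticycle hG
  induction Y using Finset.strongInduction with
  | H Y ih =>
    have key : ∀ x ∈ Y, (∀ y ∈ Y, ∀ z ∈ Y, ¬ EvenConn G A x y → ¬ EvenConn G A x z →
        ¬ EvenConn G A y z) → RegLE k (quadric (EvenConn G A) Y) 2 := by
      intro x hx h
      refine regLE_quadric_of_erase (fun _ _ h => h.symm) hx le_rfl ?_ (ih _ (erase_ssubset hx))
      rw [quadric_eq_empty]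
      · exact RegLE.empty
      · intro u hu v hv
        simp only [mem_filter, mem_erase] at hu hv
        exact h u hu.1.2 v hv.1.2 hu.2 hv.2
    by_cases hloop : ∃ a ∈ Y, EvenConn G A a a
    · obtain ⟨a, ha, haa⟩ := hloop
      exact key a ha fun y _ z _ hy hz hyz => (haa.of_loop hgap hA hyz).elim hy hz
    push Not at hloop
    rcases Y.eq_empty_or_nonempty with rfl | hne
    · rw [quadric_eq_empty (by simp)]
      exact RegLE.empty
    obtain ⟨x, hx, h⟩ := exists_cosimplicial (fun _ _ h => h.symm) hne hloop
      fun n w _ hw => hG n w (hw.of_evenConn hgap hA)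
    exact key x hx h

theorem regLE_quadric_of_good {r : ℕ} (hG : Good r G) {A : Multiset (Sym2 V)} (hA : IsEdges G A)
    (Y : Finset V) : RegLE k (quadric (EvenConn G A) Y) (r + 2) := by
  classical
  induction r generalizing G A Y with
  | zero => simpa using regLE_quadric_of_no_anticycle hG hA Y
  | succ r ih =>
    induction Y using Finset.strongInduction with
    | H Y ihY =>
      by_cases h : ∃ x ∈ Y, ∃ y ∈ Y, EvenConn G A x y
      · obtain ⟨x, hx, y, hy, hxy⟩ := h
        refine regLE_quadric_of_erase (fun _ _ h => h.symm) hx (by push_cast; linarith) ?_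
          (ihY _ (erase_ssubset hx))
        obtain ⟨z, hz⟩ : ∃ z, G.Adj x z :=
          hxy.adj_or.elim (fun h => ⟨_, h⟩) fun ⟨p, _, _, _, h, _⟩ => ⟨p, h⟩
        -- Adjacent vertices are even-connected, so this is an induced subgraph of `G - N[x]`.
        have hgood : Good r (restrict G {y | y ≠ x ∧ ¬ EvenConn G A x y}) := by
          convert (hG x z hz).restrict {y | y ≠ x ∧ ¬ EvenConn G A x y} using 1
          ext u v
          have hu := EvenConn.of_adj (A := A) (G := G) (u := x) (v := u)
          have hv := EvenConn.of_adj (A := A) (G := G) (u := x) (v := v)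
          simp only [restrict, Set.mem_ofPred_eq]
          tauto
        have := ih hgood (isEdges_filter_restrict hA _)
          ((Y.erase x).filter fun y => ¬ EvenConn G A x y)
        have e : ((r + 1 : ℕ) : ℤ) + 2 - 1 = r + 2 := by push_cast; ring
        rw [e]
        convert this using 1
        refine quadric_congr fun u hu v hv => ?_
        simp only [mem_filter, mem_erase] at hu hv
        convert (evenConn_restrict_iff (G := G) (A := A) rfl ⟨hu.1.1, hu.2⟩ ⟨hv.1.1, hv.2⟩).symm
      · push Not at h
        rw [quadric_eq_empty h]
        exact RegLE.empty

theorem regLE_powerSet_of_good {r : ℕ} (hG : Good r G) {s : ℕ} (hs : 1 ≤ s) :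
    RegLE k (powerSet G s) (2 * s + r) := by
  induction s, hs using Nat.le_induction with
  | base =>
    have h := regLE_quadric_of_good (k := k) hG (A := 0) (by simp [IsEdges]) univ
    rw [← colon_powerSet (by simp [IsEdges])] at h
    convert h using 1
    · simp
    · push_cast; ring
  | succ s hs ih =>
    refine regLE_powerSet_succ ?_ (ih.mono (by push_cast; linarith)) fun A hA _ Y => ?_
    · push_cast; linarith
    · exact (regLE_quadric_of_good hG hA Y).mono (by push_cast; linarith)

end Bound

/-! ### Powers of edge ideals -/

theorem span_edges_pow {k : Type*} [Field k] {V : Type*} [DecidableEq V] {G : SimpleGraph V} (s : ℕ) :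
    (Ideal.span {p : MvPolynomial V k | ∃ u v, G.Adj u v ∧ p = X u * X v}) ^ s =
      Ideal.span ((fun m => monomial m (1 : k)) ''
        {m | ∃ B, IsEdges G B ∧ Multiset.card B = s ∧ degs B = m}) := by
  have hX : ∀ u v : V, (X u * X v : MvPolynomial V k) =
      monomial (Finsupp.single u 1 + Finsupp.single v 1) 1 := fun u v => by
    rw [X, X, monomial_mul, one_mul]
  induction s with
  | zero =>
    rw [pow_zero, Ideal.one_eq_top, eq_comm, Ideal.eq_top_iff_one]
    exact Ideal.subset_span ⟨0, ⟨0, by simp [IsEdges], rfl, rfl⟩, rfl⟩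
  | succ s ih =>
    rw [pow_succ', ih, Ideal.span_mul_span']
    congr 1
    ext p
    constructor
    · rintro ⟨_, ⟨u, v, huv, rfl⟩, _, ⟨_, ⟨B, hB, hc, rfl⟩, rfl⟩, rfl⟩
      refine ⟨_, ⟨s(u, v) ::ₘ B, isEdges_cons.2 ⟨huv, hB⟩, by simp [hc], rfl⟩, ?_⟩
      simp only [hX, monomial_mul, one_mul, degs_cons]
    · rintro ⟨_, ⟨B, hB, hc, rfl⟩, rfl⟩
      obtain ⟨e, he⟩ := Multiset.card_pos_iff_exists_mem.1 (by omega : 0 < Multiset.card B)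
      obtain ⟨B, rfl⟩ := Multiset.exists_cons_of_mem he
      induction e using Sym2.ind with
      | h u v =>
        obtain ⟨huv, hB⟩ := isEdges_cons.1 hB
        refine ⟨_, ⟨u, v, huv, rfl⟩, _, ⟨_, ⟨B, hB, by simpa using hc, rfl⟩, rfl⟩, ?_⟩
        simp only [hX, monomial_mul, one_mul, degs_cons]

theorem mem_span_edges_pow {k : Type*} [Field k] {V : Type*} [DecidableEq V] {G : SimpleGraph V} (s : ℕ) (p : MvPolynomial V k) :
    p ∈ (Ideal.span {p : MvPolynomial V k | ∃ u v, G.Adj u v ∧ p = X u * X v}) ^ s ↔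
      ∀ m ∈ p.support, m ∈ powerSet G s := by
  rw [span_edges_pow, mem_ideal_span_monomial_image]
  refine forall₂_congr fun m _ => ?_
  constructor
  · rintro ⟨_, ⟨B, hB, hc, rfl⟩, hle⟩
    exact ⟨B, hB, hc, hle⟩
  · rintro ⟨B, hB, hc, hle⟩
    exact ⟨_, ⟨B, hB, hc, rfl⟩, hle⟩

theorem idealRegularity_edges_pow_le_iff {k : Type*} [Field k] {V : Type*} [LinearOrder V]
    [Fintype V] {G : SimpleGraph V} {s : ℕ} {r : ℤ} :
    idealRegularity ((Ideal.span {p : MvPolynomial V k | ∃ u v, G.Adj u v ∧ p = X u * X v}) ^ s) ≤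
      ((r : WithTop ℤ) : WithBot (WithTop ℤ)) ↔ RegLE k (powerSet G s) r :=
  idealRegularity_le_iff (mem_span_edges_pow s) (isUpperSet_powerSet G s)

end EdgePower

namespace FiniteGraph

open EdgePower SimplicialKoszul

/-- A linear order on the vertices of a finite graph. -/
noncomputable abbrev vertexOrder (G : FiniteGraph.{u}) : LinearOrder G.V :=
  LinearOrder.lift' (Fintype.equivFin G.V) (Fintype.equivFin G.V).injective

/-- Each deletion of a closed neighbourhood lowers the bound `r + 2` on `f` by one; once `f ≤ 2`,
the edge ideal has regularity at most two. -/
theorem good_of_hierarchy (k : Type v) [Field k] (F : Set FiniteGraph.{u}) (hF : IsHierarchy F)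
    (f : F → ℕ) (hreg : ∀ G : F, idealRegularity (G.1.edgeIdeal k) ≤ ((f G : ℤ) : WithTop ℤ))
    (hf : ∀ (G : F) (hG : G.1.IsNonempty) (w : G.1.V), ¬ G.1.graph.IsIsolated w →
      f ⟨G.1.deleteClosedNeighborhood w, (hF G.1 G.2 hG w).2⟩ ≤ max (f G - 1) 2)
    (r : ℕ) (G : F) (hr : f G ≤ r + 2) : Good r G.1.graph := by
  induction r generalizing G with
  | zero =>
    let := G.1.vertexOrder
    have h := hreg G
    rw [← pow_one (G.1.edgeIdeal k)] at h
    have h' := (idealRegularity_edges_pow_le_iff (k := k) (G := G.1.graph)).1 h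
    exact not_isAnticycle_of_regLE (h'.mono (by exact_mod_cast hr))
  | succ r ih =>
    intro x y hxy
    have hne : G.1.IsNonempty := ⟨s(x, y), hxy⟩
    have h := hf G hne x fun hiso => hiso y hxy
    refine (ih _ (h.trans (by omega))).map (φ := Subtype.val) Subtype.val_injective fun u v => ?_
    have hmem : ∀ t, t ∈ (G.1.closedNeighborhood x)ᶜ ↔ t ≠ x ∧ ¬ G.1.graph.Adj x t := by
      intro t
      simp only [closedNeighborhood, Set.mem_compl_iff, Set.mem_union, SimpleGraph.mem_neighborSet,
        Set.mem_singleton_iff]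
      tauto
    constructor
    · rintro ⟨h1, h2, h3⟩
      exact ⟨⟨u, (hmem u).2 h2⟩, ⟨v, (hmem v).2 h3⟩, rfl, rfl, h1⟩
    · rintro ⟨u', v', rfl, rfl, h1⟩
      exact ⟨h1, (hmem _).1 u'.2, (hmem _).1 v'.2⟩

theorem idealRegularity_edgeIdeal_pow_le (k : Type v) [Field k]
    (F : Set FiniteGraph.{u}) (hF : IsHierarchy F)
    (f : F → ℕ)
    (hreg : ∀ G : F, idealRegularity (G.1.edgeIdeal k) ≤ ((f G : ℤ) : WithTop ℤ))
    (hf : ∀ (G : F) (hG : G.1.IsNonempty) (w : G.1.V), ¬ G.1.graph.IsIsolated w →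
      f ⟨G.1.deleteClosedNeighborhood w, (hF G.1 G.2 hG w).2⟩ ≤ max (f G - 1) 2)
    (G : F) (s : ℕ) (hs : 1 ≤ s) :
    idealRegularity ((G.1.edgeIdeal k) ^ s) ≤ ((2 * s + f G - 2 : ℤ) : WithTop ℤ) := by
  let := G.1.vertexOrder
  refine (idealRegularity_edges_pow_le_iff (k := k) (G := G.1.graph)).2 ?_
  have h := hreg G
  rw [← pow_one (G.1.edgeIdeal k)] at h
  have h' := (idealRegularity_edges_pow_le_iff (k := k) (G := G.1.graph)).1 h
  by_cases hne : ∃ u v, G.1.graph.Adj u v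
  · obtain ⟨u, v, huv⟩ := hne
    have h2 : 2 ≤ f G := by exact_mod_cast two_le_of_regLE h' huv
    obtain ⟨r, hr⟩ := Nat.exists_eq_add_of_le h2
    have hgood := good_of_hierarchy k F hF f hreg hf r G
      (by omega)
    convert regLE_powerSet_of_good (k := k) hgood hs using 1
    rw [hr]; push_cast; ring
  -- Without edges the power is the zero ideal, as `s ≥ 1`, so the bound holds even if `f` is less
  -- than two.
  · suffices h0 : powerSet G.1.graph s = ∅ by
      rw [h0]
      exact RegLE.empty
    refine Set.eq_empty_of_forall_notMem ?_
    rintro m ⟨B, hB, hc, -⟩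
    obtain ⟨e, he⟩ := Multiset.card_pos_iff_exists_mem.1 (by omega : 0 < Multiset.card B)
    induction e using Sym2.ind with
    | h a b => exact hne ⟨a, b, hB _ he⟩

end FiniteGraph

theorem theorem3p2 (k : Type v) [Field k] [Infinite k]
    (F : Set FiniteGraph.{u}) (hF : FiniteGraph.IsHierarchy F)
    (f : F → ℕ)
    (hreg : ∀ G : F, idealRegularity (G.1.edgeIdeal k) ≤ ((f G : ℤ) : WithTop ℤ))
    (hf : ∀ (G : F) (hG : G.1.IsNonempty) (w : G.1.V), ¬ G.1.graph.IsIsolated w →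
      f ⟨G.1.deleteVertex w, (hF G.1 G.2 hG w).1⟩ ≤ f G ∧
      f ⟨G.1.deleteClosedNeighborhood w, (hF G.1 G.2 hG w).2⟩ ≤ max (f G - 1) 2)
    (G : F) (s : ℕ) (hs : 1 ≤ s) :
    idealRegularity ((G.1.edgeIdeal k) ^ s) ≤ ((2 * s + f G - 2 : ℤ) : WithTop ℤ) := by
  exact FiniteGraph.idealRegularity_edgeIdeal_pow_le k F hF f hreg
    (fun G hG w hw => (hf G hG w hw).2) G s hs
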